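/- Let $n \ge 2$ and fix $\eta \in C_c^\infty(\mathbb R^n)$ (real-valued) with $\int_{\mathbb R^n} \eta \ne 0$; write $\eta_t(x) = t^{-n}\eta(x/t)$ for $t > 0$. Let \[\mathcal H^1(\mathbb R^n) = \Big\{h \in \mathcal S'(\mathbb R^n) : \sup_{t>0} |h * \eta_t| \in L^1(\mathbb R^n)\Big\}, \qquad \|h\|_{\mathcal H^1} = \Big\|\sup_{t>0}|h*\eta_t|\Big\|_{L^1},\] be the real Hardy space. For $u = (u_1,\dots,u_n) \in W^{1,n}(\mathbb R^n,\mathbb R^n)$ let \[\|u\|_{W^{1,n}} = \Big(\int_{\mathbb R^n}|u|^n + \sum_{i,j=1}^n \int_{\mathbb R^n} |\partial_j u_i|^n\Big)^{1/n}\] and let $Ju = \det(\partial_j u_i)_{i,j=1}^n \in L^1(\mathbb R^n)$ be the Jacobian determinant. Then the set of all $h \in \mathcal H^1(\mathbb R^n)$ of the form \[h = \sum_{j=1}^\infty \lambda^j J u^j, \qquad \lambda^j \in \mathbb R, \quad \sum_{j=1}^\infty |\lambda^j| < \infty, \quad u^j \in W^{1,n}(\mathbb R^n,\mathbb R^n),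 \quad \|u^j\|_{W^{1,n}} \le 1 \text{ for every } j,\] where the series is understood in $\mathcal S'(\mathbb R^n)$ (as is in particular any series that converges in $\mathcal H^1(\mathbb R^n)$), is of the first category in $\mathcal H^1(\mathbb R^n)$ with its norm topology. -/

import Mathlib

open MeasureTheory Filter Topology
open scoped ENNReal ContDiff SchwartzMap Distributions

noncomputable section

/-- Euclidean space `ℝⁿ`. -/
abbrev RSpace (n : ℕ) : Type := EuclideanSpace ℝ (Fin n)

/-- The real test functions `C_c^∞(ℝⁿ)`. -/
abbrev TestFn (n : ℕ) : Type := 𝓓((⊤ : TopologicalSpace.Opens (RSpace n)), ℝ)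

/-- The real tempered distributions `𝒮'(ℝⁿ)`. -/
abbrev RealTempered (n : ℕ) : Type := 𝓢(RSpace n, ℝ) →L[ℝ] ℝ

/-! ### The Sobolev space `W^{1,n}(ℝⁿ, ℝⁿ)` and the Jacobian -/

/-- The partial derivative `∂_j φ` of a function on `ℝⁿ`. -/
def partialDeriv {n : ℕ} (j : Fin n) (φ : RSpace n → ℝ) (x : RSpace n) : ℝ :=
  fderiv ℝ φ x (EuclideanSpace.single j 1)

/-- A mapping `u ∈ W^{1,n}(ℝⁿ, ℝⁿ)`: a function `u ∈ Lⁿ` with its matrix of weak partial derivatives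
`grad · i j = ∂_j u_i`, all of which are in `Lⁿ`. -/
structure SobolevMap (n : ℕ) where
  /-- The mapping `u`. -/
  toFun : RSpace n → RSpace n
  /-- The weak derivative `D u`. -/
  grad : RSpace n → Matrix (Fin n) (Fin n) ℝ
  memLp_toFun : MemLp toFun (n : ℝ≥0∞) volume
  memLp_grad : ∀ i j, MemLp (fun x => grad x i j) (n : ℝ≥0∞) volume
  weak_deriv : ∀ (i j : Fin n) (φ : TestFn n),
    ∫ x, toFun x i * partialDeriv j φ x = - ∫ x, grad x i j * φ x

namespace SobolevMap

variable {n : ℕ}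

/-- `‖u‖_{W^{1,n}} = (∫ |u|ⁿ + ∑_{i,j} ∫ |∂_j u_i|ⁿ)^{1/n}`. -/
def sobolevNorm (u : SobolevMap n) : ℝ≥0∞ :=
  ((∫⁻ x, ‖u.toFun x‖ₑ ^ n) + ∑ i, ∑ j, ∫⁻ x, ‖u.grad x i j‖ₑ ^ n) ^ (1 / (n : ℝ))

/-- The Jacobian determinant `J u = det (D u)`. -/
def jacobian (u : SobolevMap n) (x : RSpace n) : ℝ := (u.grad x).det

end SobolevMap

/-! ### The real Hardy space `ℋ¹(ℝⁿ)` -/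

section Hardy

variable {n : ℕ}

/-- The function `y ↦ η_t(x - y)`, where `η_t(z) = t⁻ⁿ η(z / t)`. -/
def mollifier (η : TestFn n) (t : Set.Ioi (0 : ℝ)) (x : RSpace n) : 𝓢(RSpace n, ℝ) :=
  HasCompactSupport.toSchwartzMap
    (f := fun y => ((t : ℝ) ^ n)⁻¹ * η ((t : ℝ)⁻¹ • (x - y)))
    (by
      have ht : (t : ℝ)⁻¹ ≠ 0 := inv_ne_zero t.2.ne'
      have h := η.hasCompactSupport.comp_homeomorph
        ((Homeomorph.subLeft x).trans (Homeomorph.smulOfNeZero _ ht))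
      exact HasCompactSupport.mul_left h)
    (by
      have h : ContDiff ℝ ∞ η := η.contDiff
      exact contDiff_const.mul (h.comp ((contDiff_const.sub contDiff_id).const_smul _)))

/-- The convolution `(h * η_t)(x)` of a tempered distribution with `η_t`. -/
def distConv (η : TestFn n) (h : RealTempered n) (t : Set.Ioi (0 : ℝ)) (x : RSpace n) : ℝ :=
  h (mollifier η t x)

/-- The maximal function `sup_{t > 0} |h * η_t|`. -/
def maximalFn (η : TestFn n) (h : RealTempered n) (x : RSpace n) : ℝ≥0∞ :=
  ⨆ t : Set.Ioi (0 : ℝ), ‖distConv η h t x‖ₑ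

theorem mollifier_eq_translate (η : TestFn n) (t : Set.Ioi (0 : ℝ)) (x : RSpace n) :
    mollifier η t x = SchwartzMap.compSubConstCLM ℝ x (mollifier η t 0) := by
  ext y
  have h : x - y = 0 - (y - x) := by abel
  change ((t : ℝ) ^ n)⁻¹ * η ((t : ℝ)⁻¹ • (x - y)) = ((t : ℝ) ^ n)⁻¹ * η ((t : ℝ)⁻¹ • (0 - (y - x)))
  rw [h]

theorem tendsto_translate_zero (f : 𝓢(RSpace n, ℝ)) :
    Tendsto (fun a : RSpace n => SchwartzMap.compSubConstCLM ℝ a f) (𝓝 0) (𝓝 f) := by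
  rw [(schwartz_withSeminorms ℝ (RSpace n) ℝ).tendsto_nhds]
  rintro ⟨k, m⟩ ε hε
  set C : ℝ := 2 ^ k * (((Finset.Iic (k, m + 1)).sup fun p => SchwartzMap.seminorm ℝ p.1 p.2) f)
    with hC
  have hC0 : 0 ≤ C := by positivity
  have hdecay : ∀ z, (1 + ‖z‖) ^ k * ‖iteratedFDeriv ℝ (m + 1) f z‖ ≤ C := fun z =>
    SchwartzMap.one_add_le_sup_seminorm_apply (𝕜 := ℝ) (m := (k, m + 1)) le_rfl le_rfl f z
  have hbound : ∀ a : RSpace n, ‖a‖ ≤ 1 →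
      SchwartzMap.seminorm ℝ k m (SchwartzMap.compSubConstCLM ℝ a f - f) ≤ C * ‖a‖ := by
    intro a ha
    refine SchwartzMap.seminorm_le_bound ℝ k m _ (by positivity) fun y => ?_
    have hfun : (⇑(SchwartzMap.compSubConstCLM ℝ a f - f) : RSpace n → ℝ)
        = (fun z => f (z - a)) - f := by
      ext z; simp
    have hsm : ContDiff ℝ m (fun z => f (z - a)) :=
      (f.smooth m).comp (contDiff_id.sub contDiff_const)
    rw [hfun, iteratedFDeriv_sub_apply hsm.contDiffAt (f.smooth m).contDiffAt,
      iteratedFDeriv_comp_sub]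
    have hdiff : ∀ z, DifferentiableAt ℝ (iteratedFDeriv ℝ m f) z := fun z =>
      ((f.smooth ⊤).differentiable_iteratedFDeriv (by exact_mod_cast ENat.natCast_lt_top m)) z
    have hmv := (convex_segment y (y - a)).norm_image_sub_le_of_norm_fderiv_le
      (f := fun z => (‖y‖ ^ k) • iteratedFDeriv ℝ m f z) (𝕜 := ℝ) (C := C)
      (fun z _ => (hdiff z).fun_const_smul _)
      (fun z hz => by
        rw [fderiv_fun_const_smul (hdiff z), norm_smul, norm_fderiv_iteratedFDeriv]
        refine le_trans ?_ (hdecay z)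
        gcongr
        rw [Real.norm_of_nonneg (by positivity)]
        gcongr
        have h1 : ‖z - y‖ ≤ ‖a‖ := by
          simpa using norm_sub_le_of_mem_segment hz
        have h2 := norm_sub_norm_le y z
        rw [norm_sub_rev] at h2
        linarith)
      (left_mem_segment ℝ _ _) (right_mem_segment ℝ _ _)
    rw [← smul_sub, norm_smul, Real.norm_of_nonneg (by positivity)] at hmv
    simpa using hmv
  have h0 : Tendsto (fun a : RSpace n => C * ‖a‖) (𝓝 0) (𝓝 0) := by
    have : Continuous fun a : RSpace n => C * ‖a‖ := by fun_prop
    simpa using this.tendsto 0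
  filter_upwards [h0.eventually (gt_mem_nhds hε), Metric.ball_mem_nhds (0 : RSpace n) one_pos]
    with a ha1 ha2
  exact (hbound a (by simpa using (Metric.mem_ball.1 ha2).le)).trans_lt ha1

theorem continuous_distConv (η : TestFn n) (h : RealTempered n) (t : Set.Ioi (0 : ℝ)) :
    Continuous (distConv η h t) := by
  have hkey : Continuous fun x => mollifier η t x := by
    rw [continuous_iff_continuousAt]
    intro x₀
    have h1 : Tendsto (fun x : RSpace n => x - x₀) (𝓝 x₀) (𝓝 0) := by
      have : Continuous fun x : RSpace n => x - x₀ := by fun_prop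
      simpa using this.tendsto x₀
    have h2 := ((SchwartzMap.compSubConstCLM ℝ x₀).continuous.tendsto _).comp
      ((tendsto_translate_zero (mollifier η t 0)).comp h1)
    rw [← mollifier_eq_translate] at h2
    refine h2.congr fun x => ?_
    rw [mollifier_eq_translate η t x]
    simp
  exact h.continuous.comp hkey

theorem measurable_maximalFn (η : TestFn n) (h : RealTempered n) :
    Measurable (maximalFn η h) :=
  (lowerSemicontinuous_iSup fun t =>
    (continuous_enorm.comp (continuous_distConv η h t)).lowerSemicontinuous).measurable

theorem maximalFn_add_le (η : TestFn n) (g h : RealTempered n) (x : RSpace n) :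
    maximalFn η (g + h) x ≤ maximalFn η g x + maximalFn η h x :=
  iSup_le fun t => (enorm_add_le (distConv η g t x) (distConv η h t x)).trans
    (add_le_add (le_iSup (fun t => ‖distConv η g t x‖ₑ) t)
      (le_iSup (fun t => ‖distConv η h t x‖ₑ) t))

theorem maximalFn_smul (η : TestFn n) (c : ℝ) (h : RealTempered n) (x : RSpace n) :
    maximalFn η (c • h) x = ‖c‖ₑ * maximalFn η h x := by
  simp only [maximalFn, ENNReal.mul_iSup]
  exact iSup_congr fun t => enorm_mul c (distConv η h t x)

theorem lintegral_maximalFn_add_le (η : TestFn n) (g h : RealTempered n) :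
    ∫⁻ x, maximalFn η (g + h) x ≤ (∫⁻ x, maximalFn η g x) + ∫⁻ x, maximalFn η h x := by
  rw [← lintegral_add_left (measurable_maximalFn η g)]
  exact lintegral_mono (maximalFn_add_le η g h)

theorem lintegral_maximalFn_smul (η : TestFn n) (c : ℝ) (h : RealTempered n) :
    ∫⁻ x, maximalFn η (c • h) x = ‖c‖ₑ * ∫⁻ x, maximalFn η h x := by
  simp_rw [maximalFn_smul]
  exact lintegral_const_mul _ (measurable_maximalFn η h)

/-- The tempered distributions `h` with `sup_{t > 0} |h * η_t| ∈ L¹(ℝⁿ)`, as a subspace of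
`𝒮'(ℝⁿ)`. -/
def hardySubmodule (η : TestFn n) : Submodule ℝ (RealTempered n) where
  carrier := {h | ∫⁻ x, maximalFn η h x < ⊤}
  add_mem' := fun {g h} hg hh =>
    (lintegral_maximalFn_add_le η g h).trans_lt (ENNReal.add_lt_top.2 ⟨hg, hh⟩)
  zero_mem' := by
    have h := lintegral_maximalFn_smul η 0 (0 : RealTempered n)
    simp only [smul_zero, enorm_zero, zero_mul] at h
    simp [h]
  smul_mem' := fun c h hh => by
    simp only [Set.mem_ofPred_eq, lintegral_maximalFn_smul] at hh ⊢
    exact ENNReal.mul_lt_top enorm_lt_top hh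

/-- The real Hardy space `ℋ¹(ℝⁿ)`. It is a separate type so that it carries only the topology of its
own norm, defined below, and not the one induced from `𝒮'(ℝⁿ)`. -/
def HardySpace (η : TestFn n) : Type := hardySubmodule η

namespace HardySpace

variable {η : TestFn n}

/-- An element of `ℋ¹(ℝⁿ)` as a tempered distribution. -/
def toDist (h : HardySpace η) : RealTempered n := Subtype.val h

instance : AddCommGroup (HardySpace η) := inferInstanceAs (AddCommGroup (hardySubmodule η))

instance : Module ℝ (HardySpace η) := inferInstanceAs (Module ℝ (hardySubmodule η))

/-- `‖h‖_{ℋ¹} = ‖sup_{t > 0} |h * η_t|‖_{L¹}`. -/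
instance : Norm (HardySpace η) := ⟨fun h => (∫⁻ x, maximalFn η h.toDist x).toReal⟩

theorem norm_def (h : HardySpace η) : ‖h‖ = (∫⁻ x, maximalFn η h.toDist x).toReal := rfl

theorem seminormedCore : SeminormedSpace.Core ℝ (HardySpace η) where
  norm_nonneg _ := ENNReal.toReal_nonneg
  norm_smul c h := by
    have hh : (c • h).toDist = c • h.toDist := rfl
    rw [norm_def, norm_def, hh, lintegral_maximalFn_smul, ENNReal.toReal_mul, toReal_enorm]
  norm_triangle g h := by
    have hg : ∫⁻ x, maximalFn η g.toDist x < ⊤ := g.2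
    have hh : ∫⁻ x, maximalFn η h.toDist x < ⊤ := h.2
    rw [norm_def, norm_def, norm_def, ← ENNReal.toReal_add hg.ne hh.ne]
    exact ENNReal.toReal_mono (ENNReal.add_lt_top.2 ⟨hg, hh⟩).ne
      (lintegral_maximalFn_add_le η g.toDist h.toDist)

/-- The metric and the topology of `ℋ¹(ℝⁿ)` given by its norm. -/
instance : SeminormedAddCommGroup (HardySpace η) := SeminormedAddCommGroup.ofCore seminormedCore

end HardySpace

end Hardy

/-- The elements of `ℋ¹(ℝⁿ)` of the form `∑_j λ^j J u^j` with `‖u^j‖_{W^{1,n}} ≤ 1` for every `j` and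
`∑_j |λ^j| < ∞`. The integrable functions `J u^j` are identified with the tempered distributions
`φ ↦ ∫ J u^j φ`, and the sum is the one in `𝒮'(ℝⁿ)`: every sum in the norm of `ℋ¹` is such a sum. -/
def jacobianSums {n : ℕ} (η : TestFn n) : Set (HardySpace η) :=
  {h | ∃ (l : ℕ → ℝ) (u : ℕ → SobolevMap n),
    (∀ j, (u j).sobolevNorm ≤ 1) ∧ (Summable fun j => |l j|) ∧
      ∀ φ : 𝓢(RSpace n, ℝ), HasSum (fun j => l j * ∫ x, (u j).jacobian x * φ x) (h.toDist φ)}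

end

/-! The Hardy norm does not increase under the dilations `h ↦ s⁻ⁿ h(·/s)`, whereas the inhomogeneous
norm of `W^{1,n}` also controls `u` itself, and this breaks the scaling of Jacobians at large
scales.

Integrating by parts moves one derivative from `Ju` onto a test function `φ`, at the price of an
undifferentiated component of `u`. Hence `|∫ Ju φ| ≤ n! sup |∂φ|` whenever `‖u‖_{W^{1,n}} ≤ 1`
(`SobolevMap.abs_integral_jacobian_mul_le`). For `φ = η_t(x - ·)` the gradient has size
`t^{-(n+1)}`, so a sum of Jacobians whose coefficients have `ℓ¹` norm at most `k` satisfies `|h *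
η_t| ≤ k K t^{-(n+1)}` everywhere (`exists_abs_distConv_boundedJacobianSums_le`). A fixed `h` with
`(h * η)(0) ≠ 0`, dilated by `s`, has `|h_s * η_s|` of order `s^{-n}` near the origin. For large `s`
this exceeds the bound, however small the multiple of `h_s` and however large `k`.

The set in question is the countable union over `k` of the sums with `ℓ¹` norm at most `k`. If the
closure of one of these contained a ball about `g`, it would contain both `g` and `g + ε h_s`, with
`ε` fixed by the radius and `s` free. The difference of two approximating sums would then be close
to `ε h_s` in the Hardy norm, yet it would differ from it after convolution with `η_s` by a fixed
amount on a fixed open set. Chebyshev's inequality excludes this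
(`isNowhereDense_boundedJacobianSums`). -/

noncomputable section

/-! ### Dilations of tempered distributions -/

section Dilation

variable {n : ℕ}

/-- The dilate `φ ↦ h (φ (s ·))` of a tempered distribution. -/
def dilate (s : Set.Ioi (0 : ℝ)) (h : RealTempered n) : RealTempered n :=
  h ∘L SchwartzMap.compCLMOfContinuousLinearEquiv ℝ
    (ContinuousLinearEquiv.smulLeft (Units.mk0 (s : ℝ) s.2.ne') : RSpace n ≃L[ℝ] RSpace n)

/-- The kernels agree: `η_t(x - s y) = s⁻ⁿ η_{t/s}(x/s - y)`. At `t = s` the scale on the right is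
`1`, which is where the lower bound of order `s⁻ⁿ` comes from. -/
theorem distConv_dilate (η : TestFn n) (h : RealTempered n) (s t : Set.Ioi (0 : ℝ))
    (x : RSpace n) :
    distConv η (dilate s h) t x
      = ((s : ℝ) ^ n)⁻¹ * distConv η h ⟨t / s, Set.mem_Ioi.2 (div_pos t.2 s.2)⟩ ((s : ℝ)⁻¹ • x) := by
  have hs : (s : ℝ) ≠ 0 := s.2.ne'
  have ht : (t : ℝ) ≠ 0 := t.2.ne'
  rw [← smul_eq_mul]
  unfold distConv dilate
  rw [← map_smul, ContinuousLinearMap.comp_apply]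
  congr 1
  ext y
  change ((t : ℝ) ^ n)⁻¹ * η ((t : ℝ)⁻¹ • (x - (s : ℝ) • y))
    = ((s : ℝ) ^ n)⁻¹ * ((((t : ℝ) / s) ^ n)⁻¹ * η (((t : ℝ) / s)⁻¹ • ((s : ℝ)⁻¹ • x - y)))
  have h1 : ((t : ℝ) / s)⁻¹ • ((s : ℝ)⁻¹ • x - y) = (t : ℝ)⁻¹ • (x - (s : ℝ) • y) := by
    simp only [smul_sub, smul_smul]
    congr 2 <;> field_simp
  rw [h1, ← mul_assoc]
  congr 1
  rw [← mul_inv, ← mul_pow, mul_div_cancel₀ _ hs]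

theorem maximalFn_dilate_le (η : TestFn n) (h : RealTempered n) (s : Set.Ioi (0 : ℝ))
    (x : RSpace n) :
    maximalFn η (dilate s h) x
      ≤ ENNReal.ofReal ((s : ℝ) ^ n)⁻¹ * maximalFn η h ((s : ℝ)⁻¹ • x) := by
  refine iSup_le fun t => ?_
  have hs : (0 : ℝ) < s := s.2
  rw [distConv_dilate, enorm_mul, Real.enorm_eq_ofReal (by positivity)]
  gcongr
  exact le_iSup (fun t => ‖distConv η h t ((s : ℝ)⁻¹ • x)‖ₑ) _

/-- The factor `s⁻ⁿ` cancels the Jacobian of `x ↦ x/s`. The inequality suffices, since dilates only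
have to stay inside a given ball. -/
theorem lintegral_maximalFn_dilate_le (η : TestFn n) (h : RealTempered n) (s : Set.Ioi (0 : ℝ)) :
    ∫⁻ x, maximalFn η (dilate s h) x ≤ ∫⁻ x, maximalFn η h x := by
  have hs : (0 : ℝ) < s := s.2
  calc ∫⁻ x, maximalFn η (dilate s h) x
      ≤ ∫⁻ x, ENNReal.ofReal ((s : ℝ) ^ n)⁻¹ * maximalFn η h ((s : ℝ)⁻¹ • x) :=
        lintegral_mono (maximalFn_dilate_le η h s)
    _ = ENNReal.ofReal ((s : ℝ) ^ n)⁻¹ * ∫⁻ x, maximalFn η h ((s : ℝ)⁻¹ • x) :=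
        lintegral_const_mul _ ((measurable_maximalFn η h).comp (measurable_const_smul _))
    _ = ENNReal.ofReal ((s : ℝ) ^ n)⁻¹ *
          ∫⁻ x, maximalFn η h x ∂(Measure.map (((s : ℝ)⁻¹) • ·) (volume : Measure (RSpace n))) := by
        rw [lintegral_map (measurable_maximalFn η h) (measurable_const_smul _)]
    _ = ∫⁻ x, maximalFn η h x := by
        rw [Measure.map_addHaar_smul _ (inv_ne_zero hs.ne'), lintegral_smul_measure, smul_eq_mul,
          ← mul_assoc, ← ENNReal.ofReal_mul (by positivity), finrank_euclideanSpace_fin,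
          inv_pow, inv_inv, abs_of_pos (by positivity),
          inv_mul_cancel₀ (by positivity), ENNReal.ofReal_one, one_mul]

/-- Dilation on the Hardy space. -/
def HardySpace.dilate {η : TestFn n} (s : Set.Ioi (0 : ℝ)) (h : HardySpace η) : HardySpace η :=
  ⟨_root_.dilate s h.toDist, (lintegral_maximalFn_dilate_le η h.toDist s).trans_lt h.2⟩

theorem HardySpace.norm_dilate_le {η : TestFn n} (s : Set.Ioi (0 : ℝ)) (h : HardySpace η) :
    ‖h.dilate s‖ ≤ ‖h‖ := by
  have hh : ∫⁻ x, maximalFn η h.toDist x < ⊤ := h.2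
  exact ENNReal.toReal_mono hh.ne (lintegral_maximalFn_dilate_le η h.toDist s)

end Dilation

/-! ### Test functions of mean zero belong to the Hardy space -/

section Atom

variable {n : ℕ}

/-- The tempered distribution `φ ↦ ∫ a φ`. -/
def TestFn.toRealTempered (a : TestFn n) : RealTempered n :=
  SchwartzMap.integralCLM ℝ volume ∘L SchwartzMap.smulLeftCLM ℝ a

theorem TestFn.toRealTempered_apply (a : TestFn n) (φ : 𝓢(RSpace n, ℝ)) :
    a.toRealTempered φ = ∫ x, a x * φ x := by
  have ha : Function.HasTemperateGrowth a :=
    (a.hasCompactSupport.toSchwartzMap a.contDiff).hasTemperateGrowth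
  simp [toRealTempered, SchwartzMap.integralCLM_apply, SchwartzMap.smulLeftCLM_apply ha]

theorem TestFn.exists_lipschitz (η : TestFn n) : ∃ L : ℝ, 0 ≤ L ∧ (∀ x, ‖fderiv ℝ η x‖ ≤ L) ∧
    ∀ x y, |η x - η y| ≤ L * ‖x - y‖ := by
  have hc : Continuous (fderiv ℝ η) := η.contDiff.continuous_fderiv (by simp)
  obtain ⟨L, hL⟩ := hc.bounded_above_of_compact_support (η.hasCompactSupport.fderiv (𝕜 := ℝ))
  refine ⟨L, (norm_nonneg _).trans (hL 0), hL, fun x y => ?_⟩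
  have hd : Differentiable ℝ η := η.contDiff.differentiable (by simp)
  exact convex_univ.norm_image_sub_le_of_norm_fderiv_le (fun z _ => hd z) (fun z _ => hL z)
    (Set.mem_univ y) (Set.mem_univ x)

theorem TestFn.exists_support_bound (η : TestFn n) : ∃ R : ℝ, 0 ≤ R ∧ ∀ x, η x ≠ 0 → ‖x‖ ≤ R := by
  obtain ⟨R, hR⟩ := η.hasCompactSupport.isCompact.isBounded.exists_norm_le
  refine ⟨max R 0, le_max_right _ _, fun x hx => (hR x ?_).trans (le_max_left _ _)⟩
  exact subset_tsupport _ hx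

/-- The exponent `n + 1` exceeds the dimension, so the bound, being uniform in `t`, makes the
maximal function integrable. The extra power of decay is due to the vanishing mean of `a`. -/
theorem TestFn.abs_distConv_le (η a : TestFn n) (ha : ∫ x, a x = 0) :
    ∃ K : ℝ, ∀ (t : Set.Ioi (0 : ℝ)) (x : RSpace n),
      |distConv η a.toRealTempered t x| ≤ K * (1 + ‖x‖) ^ (-((n : ℝ) + 1)) := by
  obtain ⟨L, hL0, -, hL⟩ := η.exists_lipschitz
  obtain ⟨R, hR0, hR⟩ := η.exists_support_bound
  obtain ⟨R', hR'0, hR'⟩ := a.exists_support_bound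
  obtain ⟨A, hA⟩ := a.continuous.bounded_above_of_compact_support a.hasCompactSupport
  have hA0 : 0 ≤ A := (norm_nonneg _).trans (hA 0)
  have hai : Integrable (fun x => a x) := a.continuous.integrable_of_hasCompactSupport
    a.hasCompactSupport
  have hηi : Integrable (fun x => η x) := η.continuous.integrable_of_hasCompactSupport
    η.hasCompactSupport
  set I : ℝ := ∫ x, |η x|
  set J : ℝ := ∫ x, |a x|
  have hI0 : 0 ≤ I := integral_nonneg fun x => abs_nonneg _
  have hJ0 : 0 ≤ J := integral_nonneg fun x => abs_nonneg _
  set M : ℝ := 1 + R + R'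
  have hM : 1 ≤ M := by simp only [M]; linarith
  refine ⟨(A * I + J * (L * R')) * M ^ (n + 1), fun t x => ?_⟩
  have ht : (0 : ℝ) < t := t.2
  have hx : (0 : ℝ) < 1 + ‖x‖ := by positivity
  have hconv : distConv η a.toRealTempered t x
      = ∫ y, a y * (((t : ℝ) ^ n)⁻¹ * η ((t : ℝ)⁻¹ • (x - y))) :=
    a.toRealTempered_apply _
  rw [show (-((n : ℝ) + 1)) = -((n + 1 : ℕ) : ℝ) by push_cast; ring, Real.rpow_neg hx.le,
    Real.rpow_natCast]
  by_cases h0 : distConv η a.toRealTempered t x = 0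
  · rw [h0, abs_zero]; positivity
  -- Supports: a nonzero integrand needs `‖y‖ ≤ R'` and `‖x - y‖ ≤ R t`.
  have hxt : ‖x‖ ≤ R' + R * t := by
    by_contra hlt
    refine h0 (hconv.trans (integral_eq_zero_of_ae (Eventually.of_forall fun y => ?_)))
    by_contra hne
    have h1 : a y ≠ 0 := left_ne_zero_of_mul hne
    have h2 : η ((t : ℝ)⁻¹ • (x - y)) ≠ 0 := right_ne_zero_of_mul (right_ne_zero_of_mul hne)
    have h3 := hR _ h2
    rw [norm_smul, Real.norm_of_nonneg (by positivity), inv_mul_le_iff₀ ht] at h3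
    have h4 := norm_le_norm_add_norm_sub' x y
    have h5 := hR' _ h1
    exact hlt (by linarith)
  have hsmall : |distConv η a.toRealTempered t x| ≤ A * I := by
    have hsub : ∫ y, ((t : ℝ) ^ n)⁻¹ * |η ((t : ℝ)⁻¹ • (x - y))| = I := by
      rw [integral_const_mul, integral_sub_left_eq_self (fun y => |η ((t : ℝ)⁻¹ • y)|),
        Measure.integral_comp_smul volume (fun y => |η y|), finrank_euclideanSpace_fin, smul_eq_mul,
        ← mul_assoc, inv_pow, inv_inv, abs_of_pos (by positivity), inv_mul_cancel₀ (by positivity),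
        one_mul]
    have hi2 : Integrable fun y => η ((t : ℝ)⁻¹ • (x - y)) :=
      (hηi.comp_smul (inv_ne_zero ht.ne')).comp_sub_left x
    rw [hconv, ← hsub, ← integral_const_mul, ← Real.norm_eq_abs]
    refine norm_integral_le_of_norm_le ((hi2.abs.const_mul _).const_mul _)
      (Eventually.of_forall fun y => ?_)
    rw [norm_mul, norm_mul, Real.norm_of_nonneg (by positivity : (0 : ℝ) ≤ ((t : ℝ) ^ n)⁻¹)]
    exact mul_le_mul_of_nonneg_right (hA y) (by positivity)
  -- As `a` has mean zero, the constant `η(x/t)` can be subtracted from the kernel; the Lipschitz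
  -- bound then gains a factor `1/t`.
  have hlarge : |distConv η a.toRealTempered t x| ≤ J * (L * R') * ((t : ℝ) ^ (n + 1))⁻¹ := by
    have hi1 : Integrable fun y => a y * (((t : ℝ) ^ n)⁻¹ * η ((t : ℝ)⁻¹ • (x - y))) := by
      have hc : Continuous fun y : RSpace n => (t : ℝ)⁻¹ • (x - y) := by fun_prop
      refine Continuous.integrable_of_hasCompactSupport ?_ a.hasCompactSupport.mul_right
      exact a.continuous.mul (continuous_const.mul (η.continuous.comp hc))
    have h1 : distConv η a.toRealTempered t x = ∫ y, a y * (((t : ℝ) ^ n)⁻¹ *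
        (η ((t : ℝ)⁻¹ • (x - y)) - η ((t : ℝ)⁻¹ • x))) := by
      have h2 : ∫ y, a y * (((t : ℝ) ^ n)⁻¹ * η ((t : ℝ)⁻¹ • x)) = 0 := by
        rw [integral_mul_const, ha, zero_mul]
      have h3 := integral_sub hi1 (hai.mul_const (((t : ℝ) ^ n)⁻¹ * η ((t : ℝ)⁻¹ • x)))
      rw [h2, sub_zero, ← hconv] at h3
      rw [← h3]
      exact integral_congr_ae (Eventually.of_forall fun y => by ring)
    rw [h1, mul_assoc, ← integral_mul_const, ← Real.norm_eq_abs]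
    refine norm_integral_le_of_norm_le (hai.abs.mul_const _) (Eventually.of_forall fun y => ?_)
    rw [norm_mul, Real.norm_eq_abs (a y)]
    by_cases hy : a y = 0
    · simp [hy]
    refine mul_le_mul_of_nonneg_left ?_ (abs_nonneg _)
    rw [norm_mul, Real.norm_of_nonneg (by positivity : (0 : ℝ) ≤ ((t : ℝ) ^ n)⁻¹),
      Real.norm_eq_abs]
    have h2 : ‖(t : ℝ)⁻¹ • (x - y) - (t : ℝ)⁻¹ • x‖ ≤ (t : ℝ)⁻¹ * R' := by
      rw [← smul_sub, norm_smul, Real.norm_of_nonneg (by positivity), sub_sub_cancel_left, norm_neg]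
      gcongr
      exact hR' y hy
    calc ((t : ℝ) ^ n)⁻¹ * |η ((t : ℝ)⁻¹ • (x - y)) - η ((t : ℝ)⁻¹ • x)|
        ≤ ((t : ℝ) ^ n)⁻¹ * (L * ((t : ℝ)⁻¹ * R')) := by
          gcongr
          exact (hL _ _).trans (by gcongr)
      _ = L * R' * ((t : ℝ) ^ (n + 1))⁻¹ := by
          rw [pow_succ, mul_inv]; ring
  have hnn : 0 ≤ J * (L * R') := by positivity
  have hnn' : 0 ≤ A * I := by positivity
  rw [← div_eq_mul_inv, le_div_iff₀ (by positivity)]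
  -- For `t ≤ 1` the point `x` stays in a fixed ball and the crude bound suffices; for `t ≥ 1` one
  -- has `1 + ‖x‖ ≤ M t`, so decay in `t` becomes decay in `x`.
  rcases le_total (t : ℝ) 1 with ht1 | ht1
  · have hxM : 1 + ‖x‖ ≤ M := by
      simp only [M]
      nlinarith
    calc _ ≤ A * I * M ^ (n + 1) := by gcongr
      _ ≤ _ := by gcongr; linarith
  · have hxM : 1 + ‖x‖ ≤ M * t := by
      simp only [M]
      nlinarith
    calc _ ≤ J * (L * R') * ((t : ℝ) ^ (n + 1))⁻¹ * (M * t) ^ (n + 1) := by gcongr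
      _ = J * (L * R') * M ^ (n + 1) := by
        rw [mul_pow]; field_simp
      _ ≤ _ := by gcongr; linarith

/-- A test function of mean zero, as an element of the Hardy space. -/
def TestFn.toHardySpace (η a : TestFn n) (ha : ∫ x, a x = 0) : HardySpace η :=
  ⟨a.toRealTempered, by
    obtain ⟨K, hK⟩ := η.abs_distConv_le a ha
    have hK0 : 0 ≤ K := by
      have h := (abs_nonneg _).trans (hK ⟨1, Set.mem_Ioi.2 one_pos⟩ 0)
      simpa using h
    have hfin := finite_integral_one_add_norm (E := RSpace n) (μ := volume) (r := (n : ℝ) + 1)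
      (by simp)
    change ∫⁻ x, maximalFn η a.toRealTempered x < ⊤
    refine lt_of_le_of_lt (lintegral_mono fun x => iSup_le fun t => ?_)
      ((lintegral_const_mul (ENNReal.ofReal K) (by fun_prop)).trans_lt
        (ENNReal.mul_lt_top ENNReal.ofReal_lt_top hfin))
    rw [← ENNReal.ofReal_mul hK0, Real.enorm_eq_ofReal_abs]
    exact ENNReal.ofReal_le_ofReal (hK t x)⟩

/-- The witness is the reflection of `η` minus a translate of it. The mean vanishes, and the
translate is so far away that pairing with the reflection leaves only `∫ η(-y)² > 0`. -/
theorem exists_hardySpace_distConv_ne_zero (hn : 0 < n) (η : TestFn n) (hη : ∃ x, η x ≠ 0) :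
    ∃ h : HardySpace η, distConv η h.toDist ⟨1, Set.mem_Ioi.2 one_pos⟩ 0 ≠ 0 := by
  obtain ⟨R, hR0, hR⟩ := η.exists_support_bound
  obtain ⟨v, hv⟩ : ∃ v : RSpace n, 2 * R < ‖v‖ := by
    refine ⟨EuclideanSpace.single ⟨0, hn⟩ (2 * R + 1), ?_⟩
    rw [PiLp.norm_single, Real.norm_of_nonneg (by positivity)]
    linarith
  have hcs : ∀ w : RSpace n, HasCompactSupport fun y => η (w - y) := fun w =>
    η.hasCompactSupport.comp_homeomorph (Homeomorph.subLeft w)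
  have hcd : ∀ w : RSpace n, ContDiff ℝ ∞ fun y => η (w - y) := fun w =>
    η.contDiff.comp (contDiff_const.sub contDiff_id)
  have hint : ∀ w : RSpace n, Integrable fun y => η (w - y) := fun w =>
    (hcd w).continuous.integrable_of_hasCompactSupport (hcs w)
  let a : TestFn n := ⟨fun y => η (0 - y) - η (v - y), (hcd 0).sub (hcd v), (hcs 0).sub (hcs v),
    Set.subset_univ _⟩
  have ha : ∫ x, a x = 0 := by
    change ∫ y, (η (0 - y) - η (v - y)) = 0
    rw [integral_sub (hint 0) (hint v), integral_sub_left_eq_self (fun y => η y),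
      integral_sub_left_eq_self (fun y => η y), sub_self]
  refine ⟨η.toHardySpace a ha, ?_⟩
  have h1 : distConv η (η.toHardySpace a ha).toDist ⟨1, Set.mem_Ioi.2 one_pos⟩ 0 = ∫ y, η (-y) ^ 2 := by
    refine (a.toRealTempered_apply _).trans (integral_congr_ae (Eventually.of_forall fun y => ?_))
    change (η (0 - y) - η (v - y)) * (((1 : ℝ) ^ n)⁻¹ * η ((1 : ℝ)⁻¹ • (0 - y))) = η (-y) ^ 2
    simp only [zero_sub, one_pow, inv_one, one_mul, one_smul]
    by_cases hy : η (-y) = 0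
    · simp [hy]
    · have h2 : η (v - y) = 0 := by
        by_contra h3
        have h4 := hR _ h3
        have h5 := hR _ hy
        rw [norm_neg] at h5
        have h6 := norm_le_norm_add_norm_sub' v y
        linarith
      rw [h2]; ring
  rw [h1]
  obtain ⟨x, hx⟩ := hη
  have hc : Continuous fun y => η (-y) ^ 2 := (η.continuous.comp continuous_neg).pow 2
  have hs : HasCompactSupport fun y => η (-y) ^ 2 := by
    have := hcs 0
    simp only [zero_sub] at this
    exact this.comp_left (g := fun z => z ^ 2) (by simp)
  refine (hc.integral_pos_of_hasCompactSupport_nonneg_nonzero hs (fun y => sq_nonneg _)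
    (x := -x) ?_).ne'
  simpa using hx

end Atom

/-! ### Integration by parts for Jacobian determinants of smooth maps -/

section SmoothJacobian

variable {n : ℕ}

/-! ### Pointwise bounds for determinants -/

theorem Matrix.abs_det_le_of_forall_abs_le {m : ℕ} {A : Matrix (Fin m) (Fin m) ℝ}
    {b : Fin m → ℝ} (h : ∀ i j, |A i j| ≤ b i) : |A.det| ≤ (Nat.factorial m : ℝ) * ∏ i, b i := by
  rw [← A.det_transpose, Matrix.det_apply]
  refine (Finset.abs_sum_le_sum_abs _ _).trans ?_
  have : ∀ σ : Equiv.Perm (Fin m), |Equiv.Perm.sign σ • ∏ i, A.transpose (σ i) i| ≤ ∏ i, b i := by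
    intro σ
    have h1 : |Equiv.Perm.sign σ • ∏ i, A.transpose (σ i) i| = ∏ i, |A i (σ i)| := by
      rw [← Finset.abs_prod]
      rcases Int.units_eq_one_or (Equiv.Perm.sign σ) with h | h <;> simp [h]
    rw [h1]
    exact Finset.prod_le_prod (fun _ _ => abs_nonneg _) fun i _ => h i _
  refine (Finset.sum_le_sum fun σ _ => this σ).trans ?_
  simp [Fintype.card_perm]

theorem Finset.prod_le_sum_pow {m : ℕ} (hm : 0 < m) (b : Fin m → ℝ) (hb : ∀ i, 0 ≤ b i) :
    ∏ i, b i ≤ ∑ i, b i ^ m := by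
  obtain ⟨k, -, hk⟩ := Finset.exists_max_image Finset.univ b ⟨⟨0, hm⟩, Finset.mem_univ _⟩
  calc ∏ i, b i ≤ ∏ _i : Fin m, b k := Finset.prod_le_prod (fun i _ => hb i) fun i hi => hk i hi
    _ = b k ^ m := by simp
    _ ≤ ∑ i, b i ^ m :=
      Finset.single_le_sum (f := fun i => b i ^ m) (fun i _ => pow_nonneg (hb i) m)
        (Finset.mem_univ k)

theorem Matrix.abs_det_le_sum_pow {m : ℕ} (hm : 0 < m) (A : Matrix (Fin m) (Fin m) ℝ) :
    |A.det| ≤ (Nat.factorial m : ℝ) * ∑ i, ∑ j, |A i j| ^ m := by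
  have : Nonempty (Fin m) := ⟨⟨0, hm⟩⟩
  have hex : ∀ i, ∃ k, ∀ j, |A i j| ≤ |A i k| := fun i => by
    obtain ⟨k, -, hk⟩ := Finset.exists_max_image Finset.univ (fun j => |A i j|)
      Finset.univ_nonempty
    exact ⟨k, fun j => hk j (Finset.mem_univ _)⟩
  choose k hk using hex
  refine (Matrix.abs_det_le_of_forall_abs_le hk).trans (mul_le_mul_of_nonneg_left ?_
    (Nat.cast_nonneg _))
  refine (Finset.prod_le_sum_pow hm _ fun i => abs_nonneg _).trans
    (Finset.sum_le_sum fun i _ => ?_)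
  exact Finset.single_le_sum (f := fun j => |A i j| ^ m) (fun _ _ => by positivity)
    (Finset.mem_univ (k i))

/-- The weight `w` is absorbed into row `i₀`, so that each Leibniz term has `m` factors, one bounded
by `M |w|`, and a product of `m` factors is at most the sum of their `m`-th powers. In the
application row `i₀` is `∇φ`, `w` is the undifferentiated component, and `B` is the full gradient.
-/
theorem Matrix.abs_det_le_of_forall_abs_le_mul {m : ℕ} (hm : 0 < m) {A : Matrix (Fin m) (Fin m) ℝ}
    {i₀ : Fin m} {M w : ℝ} {B : Matrix (Fin m) (Fin m) ℝ} (hM : 0 ≤ M)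
    (h₀ : ∀ j, |w * A i₀ j| ≤ M * |w|)
    (h : ∀ i ≠ i₀, ∀ j, A i j = B i j) :
    |w * A.det| ≤ (Nat.factorial m : ℝ) * M * (|w| ^ m + ∑ i, ∑ j, |B i j| ^ m) := by
  have : Nonempty (Fin m) := ⟨⟨0, hm⟩⟩
  have hex : ∀ i, ∃ k, ∀ j, |B i j| ≤ |B i k| := fun i => by
    obtain ⟨k, -, hk⟩ := Finset.exists_max_image Finset.univ (fun j => |B i j|)
      Finset.univ_nonempty
    exact ⟨k, fun j => hk j (Finset.mem_univ _)⟩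
  choose k hk using hex
  set c : Fin m → ℝ := fun i => if i = i₀ then |w| else |B i (k i)| with hc
  have hc0 : ∀ i, 0 ≤ c i := fun i => by simp only [hc]; split_ifs <;> exact abs_nonneg _
  have h1 : w * A.det = (A.updateRow i₀ (w • A i₀)).det := by
    rw [Matrix.det_updateRow_smul, Matrix.updateRow_eq_self]
  have h2 : |(A.updateRow i₀ (w • A i₀)).det|
      ≤ (Nat.factorial m : ℝ) * ∏ i, (if i = i₀ then M * |w| else |B i (k i)|) := by
    refine Matrix.abs_det_le_of_forall_abs_le fun i j => ?_
    by_cases hi : i = i₀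
    · subst hi
      simpa [Matrix.updateRow_self] using h₀ j
    · rw [Matrix.updateRow_ne hi, if_neg hi, h i hi]
      exact hk i j
  have h3 : ∏ i, (if i = i₀ then M * |w| else |B i (k i)|) = M * ∏ i, c i := by
    rw [← Finset.mul_prod_erase _ _ (Finset.mem_univ i₀),
      ← Finset.mul_prod_erase Finset.univ c (Finset.mem_univ i₀), ← mul_assoc]
    simp only [hc, if_true]
    congr 1
    exact Finset.prod_congr rfl fun i hi => by simp [Finset.ne_of_mem_erase hi]
  have h4 : ∑ i, c i ^ m ≤ |w| ^ m + ∑ i, ∑ j, |B i j| ^ m := by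
    calc ∑ i, c i ^ m ≤ ∑ i, ((if i = i₀ then |w| ^ m else 0) + ∑ j, |B i j| ^ m) := by
          refine Finset.sum_le_sum fun i _ => ?_
          have hs : |B i (k i)| ^ m ≤ ∑ j, |B i j| ^ m :=
            Finset.single_le_sum (f := fun j => |B i j| ^ m) (fun _ _ => by positivity)
              (Finset.mem_univ (k i))
          have hs0 : 0 ≤ |B i (k i)| ^ m := by positivity
          simp only [hc]
          split_ifs <;> linarith
      _ = _ := by simp [Finset.sum_add_distrib]
  rw [h1]
  calc _ ≤ (Nat.factorial m : ℝ) * (M * ∏ i, c i) := h3 ▸ h2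
    _ ≤ (Nat.factorial m : ℝ) * (M * (|w| ^ m + ∑ i, ∑ j, |B i j| ^ m)) := by
      gcongr
      exact (Finset.prod_le_sum_pow hm c hc0).trans h4
    _ = _ := by ring

/-- The matrix of partial derivatives `∂_j v_i`. -/
def gradMatrix (v : Fin n → RSpace n → ℝ) (x : RSpace n) : Matrix (Fin n) (Fin n) ℝ :=
  Matrix.of fun i j => partialDeriv j (v i) x

/-! ### Derivatives of determinants and cofactors -/

theorem contDiff_partialDeriv {m k : WithTop ℕ∞} (j : Fin n) {φ : RSpace n → ℝ}
    (hφ : ContDiff ℝ k φ) (hk : m + 1 ≤ k) : ContDiff ℝ m (partialDeriv j φ) :=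
  (hφ.fderiv_right hk).clm_apply contDiff_const

theorem partialDeriv_comm {φ : RSpace n → ℝ} (hφ : ContDiff ℝ 2 φ) (j k : Fin n) (x : RSpace n) :
    partialDeriv j (partialDeriv k φ) x = partialDeriv k (partialDeriv j φ) x := by
  have hd : DifferentiableAt ℝ (fderiv ℝ φ) x :=
    (hφ.fderiv_right (m := 1) (by norm_num)).differentiable one_ne_zero x
  have h : ∀ i l : Fin n, partialDeriv i (partialDeriv l φ) x
      = fderiv ℝ (fderiv ℝ φ) x (EuclideanSpace.single i 1) (EuclideanSpace.single l 1) := by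
    intro i l
    have := (hd.hasFDerivAt.clm_apply
      (hasFDerivAt_const (EuclideanSpace.single l (1 : ℝ)) x)).fderiv
    change fderiv ℝ (fun y => fderiv ℝ φ y (EuclideanSpace.single l 1)) x _ = _
    rw [this]
    simp
  rw [h, h]
  exact hφ.contDiffAt.isSymmSndFDerivAt (by simp) _ _

theorem contDiff_det {E : Type*} [NormedAddCommGroup E] [NormedSpace ℝ E] {k : WithTop ℕ∞}
    {A : E → Matrix (Fin n) (Fin n) ℝ} (hA : ∀ i j, ContDiff ℝ k fun x => A x i j) :
    ContDiff ℝ k fun x => (A x).det := by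
  simp only [Matrix.det_apply]
  exact ContDiff.sum fun σ _ => (contDiff_prod fun i _ => hA _ _).const_smul _

theorem fderiv_det {E : Type*} [NormedAddCommGroup E] [NormedSpace ℝ E]
    {A : E → Matrix (Fin n) (Fin n) ℝ} {x : E} (hA : ∀ i j, DifferentiableAt ℝ (fun x => A x i j) x)
    (w : E) : fderiv ℝ (fun x => (A x).det) x w
      = ∑ i, ((A x).updateRow i fun j => fderiv ℝ (fun x => A x i j) x w).det := by
  let D : ContinuousMultilinearMap ℝ (fun _ : Fin n => Fin n → ℝ) ℝ :=
    ⟨Matrix.detRowAlternating.toMultilinearMap, by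
      change Continuous fun A : Matrix (Fin n) (Fin n) ℝ => A.det
      exact Continuous.matrix_det continuous_id⟩
  have hrow : ∀ i, HasFDerivAt (fun x => A x i)
      (ContinuousLinearMap.pi fun j => fderiv ℝ (fun x => A x i j) x) x := fun i =>
    hasFDerivAt_pi.2 fun j => (hA i j).hasFDerivAt
  have h := (HasFDerivAt.multilinear_comp D hrow).fderiv
  change fderiv ℝ (fun x => D fun i => A x i) x w = _
  rw [h, _root_.sum_apply]
  rfl

/-- The rows of the cofactor matrix of a gradient are divergence free. -/
theorem sum_partialDeriv_cofactor {v : Fin n → RSpace n → ℝ} (hv : ∀ i, ContDiff ℝ 2 (v i))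
    (i₀ : Fin n) (x : RSpace n) :
    ∑ j, partialDeriv j (fun y => ((gradMatrix v y).updateRow i₀ (Pi.single j 1)).det) x = 0 := by
  set H : Fin n → Fin n → Fin n → ℝ := fun i j k => partialDeriv j (partialDeriv k (v i)) x with hH
  have hHs : ∀ i j k, H i j k = H i k j := fun i j k => partialDeriv_comm (hv i) j k x
  set G := gradMatrix v x with hG
  set B : Fin n → Fin n → Fin n → ℝ := fun i j k =>
    ((G.updateRow i₀ (Pi.single j 1)).updateRow i (Pi.single k 1)).det with hB
  have hdiff : ∀ i k, DifferentiableAt ℝ (partialDeriv k (v i)) x := fun i k =>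
    (contDiff_partialDeriv (m := 1) k (hv i) (by norm_num)).differentiable one_ne_zero x
  -- Differentiating row by row: row `i₀` is constant and contributes nothing, and each other row
  -- becomes a row of second derivatives, expanded in the standard basis.
  have hterm : ∀ j, partialDeriv j
      (fun y => ((gradMatrix v y).updateRow i₀ (Pi.single j 1)).det) x
      = ∑ i ∈ Finset.univ.erase i₀, ∑ k, H i j k * B i j k := by
    intro j
    unfold partialDeriv
    rw [fderiv_det, ← Finset.add_sum_erase _ _ (Finset.mem_univ i₀)]
    · have h0 : (((gradMatrix v x).updateRow i₀ (Pi.single j 1)).updateRow i₀ fun l =>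
          fderiv ℝ (fun y => (gradMatrix v y).updateRow i₀ (Pi.single j 1) i₀ l) x
            (EuclideanSpace.single j 1)).det = 0 := by
        refine Matrix.det_eq_zero_of_row_eq_zero i₀ fun l => ?_
        simp [Matrix.updateRow_self]
      rw [h0, zero_add]
      refine Finset.sum_congr rfl fun i hi => ?_
      have hi' := Finset.ne_of_mem_erase hi
      have h1 : (fun l => fderiv ℝ (fun y => (gradMatrix v y).updateRow i₀ (Pi.single j 1) i l) x
          (EuclideanSpace.single j 1)) = ∑ k, H i j k • (Pi.single k (1 : ℝ) : Fin n → ℝ) := by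
        ext l
        simp only [Matrix.updateRow_ne hi', Finset.sum_apply, Pi.smul_apply, Pi.single_apply,
          smul_eq_mul, mul_ite, mul_one, mul_zero, Finset.sum_ite_eq, Finset.mem_univ, if_true]
        rfl
      rw [h1]
      have h2 := (Matrix.detRowAlternating (R := ℝ) (n := Fin n)).toMultilinearMap.map_update_sum
        Finset.univ i (fun k => H i j k • (Pi.single k (1 : ℝ) : Fin n → ℝ))
        (G.updateRow i₀ (Pi.single j 1))
      refine h2.trans (Finset.sum_congr rfl fun k _ => ?_)
      exact Matrix.det_updateRow_smul _ _ _ _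
    · intro i l
      by_cases hi : i = i₀
      · subst hi
        simp only [Matrix.updateRow_self]
        exact differentiableAt_const _
      · simp only [Matrix.updateRow_ne hi]
        exact hdiff i l
  -- Exchanging `j` and `k` amounts to swapping the rows `i₀` and `i`.
  have hBs : ∀ i ∈ Finset.univ.erase i₀, ∀ j k, B i j k = - B i k j := by
    intro i hi j k
    have hi' := Finset.ne_of_mem_erase hi
    have h1 : (G.updateRow i₀ (Pi.single k 1)).updateRow i (Pi.single j 1)
        = ((G.updateRow i₀ (Pi.single j 1)).updateRow i (Pi.single k 1)).submatrix
          (Equiv.swap i₀ i) id := by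
      ext a b
      by_cases ha : a = i
      · subst ha
        simp [Matrix.updateRow_apply, hi'.symm]
      · by_cases ha0 : a = i₀
        · subst ha0
          simp [Matrix.updateRow_apply, hi'.symm]
        · simp [Matrix.updateRow_apply, ha, ha0, Equiv.swap_apply_of_ne_of_ne ha0 ha]
    simp only [hB]
    rw [h1, Matrix.det_permute, Equiv.Perm.sign_swap hi'.symm]
    simp
  simp only [hterm]
  rw [Finset.sum_comm]
  refine Finset.sum_eq_zero fun i hi => ?_
  -- A symmetric array (the Hessian) is contracted with an antisymmetric one.
  have h1 : ∑ j, ∑ k, H i j k * B i j k = - ∑ j, ∑ k, H i j k * B i j k := by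
    conv_lhs => rw [Finset.sum_comm]
    rw [← Finset.sum_neg_distrib]
    refine Finset.sum_congr rfl fun j _ => ?_
    rw [← Finset.sum_neg_distrib]
    refine Finset.sum_congr rfl fun k _ => ?_
    rw [hHs i k j, hBs i hi k j, mul_neg]
  linarith

/-- Laplace expansion along row `i₀`, with the cofactors written as determinants. -/
theorem sum_mul_det_updateRow_single (G : Matrix (Fin n) (Fin n) ℝ) (i₀ : Fin n) (r : Fin n → ℝ) :
    ∑ j, r j * (G.updateRow i₀ (Pi.single j 1)).det = (G.updateRow i₀ r).det := by
  have h1 : r = ∑ k, r k • (Pi.single k (1 : ℝ) : Fin n → ℝ) := by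
    ext l
    simp [Finset.sum_apply, Pi.single_apply]
  conv_rhs => rw [h1]
  have h2 := (Matrix.detRowAlternating (R := ℝ) (n := Fin n)).toMultilinearMap.map_update_sum
    Finset.univ i₀ (fun k => r k • (Pi.single k (1 : ℝ) : Fin n → ℝ)) G
  exact ((h2.trans (Finset.sum_congr rfl fun k _ => Matrix.det_updateRow_smul _ _ _ _)).symm)

theorem integral_partialDeriv_mul {f g : RSpace n → ℝ} (hf : ContDiff ℝ 1 f)
    (hfs : HasCompactSupport f) (hg : ContDiff ℝ 1 g) (j : Fin n) :
    ∫ x, partialDeriv j f x * g x = - ∫ x, f x * partialDeriv j g x := by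
  have hf' : Continuous (partialDeriv j f) :=
    (contDiff_partialDeriv (m := 0) j hf (by simp)).continuous
  have hg' : Continuous (partialDeriv j g) :=
    (contDiff_partialDeriv (m := 0) j hg (by simp)).continuous
  have hfs' : HasCompactSupport (partialDeriv j f) := hfs.fderiv_apply (𝕜 := ℝ) _
  rw [eq_neg_iff_add_eq_zero, ← neg_eq_iff_add_eq_zero, eq_comm]
  exact integral_mul_fderiv_eq_neg_fderiv_mul_of_integrable
    ((hf'.mul hg.continuous).integrable_of_hasCompactSupport hfs'.mul_right)
    ((hf.continuous.mul hg').integrable_of_hasCompactSupport hfs.mul_right)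
    ((hf.continuous.mul hg.continuous).integrable_of_hasCompactSupport hfs.mul_right)
    (fun x _ => hf.differentiable one_ne_zero x) (fun x _ => hg.differentiable one_ne_zero x)

theorem partialDeriv_mul {f g : RSpace n → ℝ} {x : RSpace n} (hf : DifferentiableAt ℝ f x)
    (hg : DifferentiableAt ℝ g x) (j : Fin n) :
    partialDeriv j (fun y => f y * g y) x
      = f x * partialDeriv j g x + g x * partialDeriv j f x := by
  simp [partialDeriv, fderiv_fun_mul hf hg]

/-- Integration by parts for the Jacobian determinant of a smooth map. -/
theorem integral_mul_det_gradMatrix {v : Fin n → RSpace n → ℝ} (hv : ∀ i, ContDiff ℝ 2 (v i))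
    {φ : RSpace n → ℝ} (hφ : ContDiff ℝ 1 φ) (hφs : HasCompactSupport φ) (i₀ : Fin n) :
    ∫ x, φ x * (gradMatrix v x).det = - ∫ x, v i₀ x *
      ((gradMatrix v x).updateRow i₀ fun j => partialDeriv j φ x).det := by
  set C : Fin n → RSpace n → ℝ := fun j y => ((gradMatrix v y).updateRow i₀ (Pi.single j 1)).det
  have hG : ∀ i j, ContDiff ℝ 1 fun x => gradMatrix v x i j := fun i j =>
    contDiff_partialDeriv (m := 1) j (hv i) (by norm_num)
  have hC : ∀ j, ContDiff ℝ 1 (C j) := fun j => contDiff_det fun i l => by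
    by_cases hi : i = i₀
    · subst hi
      simp only [Matrix.updateRow_self]
      exact contDiff_const
    · simp only [Matrix.updateRow_ne hi]
      exact hG i l
  have hv1 : ContDiff ℝ 1 (v i₀) := (hv i₀).of_le (by norm_num)
  set f : RSpace n → ℝ := fun x => φ x * v i₀ x with hfdef
  have hf : ContDiff ℝ 1 f := hφ.mul hv1
  have hfs : HasCompactSupport f := hφs.mul_right
  have hφ' : ∀ j, Continuous (partialDeriv j φ) := fun j =>
    (contDiff_partialDeriv (m := 0) j hφ (by simp)).continuous
  -- By the product rule for `f = φ v_{i₀}`, the two integrands add up to `∇f · C`; this integrates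
  -- to zero because `f` has compact support and `C` is divergence free.
  have hsplit : ∀ x, φ x * (gradMatrix v x).det
      + v i₀ x * ((gradMatrix v x).updateRow i₀ fun j => partialDeriv j φ x).det
      = ∑ j, partialDeriv j f x * C j x := by
    intro x
    have h1 : (gradMatrix v x).det
        = ∑ j, partialDeriv j (v i₀) x * ((gradMatrix v x).updateRow i₀ (Pi.single j 1)).det := by
      rw [sum_mul_det_updateRow_single]
      exact congrArg Matrix.det (Matrix.updateRow_eq_self (gradMatrix v x) i₀).symm
    rw [h1, ← sum_mul_det_updateRow_single _ _ (fun j => partialDeriv j φ x), Finset.mul_sum,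
      Finset.mul_sum, ← Finset.sum_add_distrib]
    refine Finset.sum_congr rfl fun j _ => ?_
    rw [hfdef, partialDeriv_mul (hφ.differentiable one_ne_zero x)
      (hv1.differentiable one_ne_zero x)]
    ring
  have hi1 : Integrable fun x => φ x * (gradMatrix v x).det :=
    (hφ.continuous.mul (contDiff_det hG).continuous).integrable_of_hasCompactSupport hφs.mul_right
  have hdir : ∀ j, Integrable fun x => partialDeriv j f x * C j x := fun j =>
    (((contDiff_partialDeriv (m := 0) j hf (by simp)).continuous).mul
      (hC j).continuous).integrable_of_hasCompactSupport (hfs.fderiv_apply (𝕜 := ℝ) _).mul_right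
  have hi2 : Integrable fun x => v i₀ x *
      ((gradMatrix v x).updateRow i₀ fun j => partialDeriv j φ x).det := by
    have := (integrable_finsetSum Finset.univ fun j _ => hdir j).sub hi1
    refine this.congr (Eventually.of_forall fun x => ?_)
    change ∑ j, partialDeriv j f x * C j x - φ x * (gradMatrix v x).det = _
    rw [← hsplit]; ring
  rw [eq_neg_iff_add_eq_zero, ← integral_add hi1 hi2]
  simp_rw [hsplit]
  rw [integral_finsetSum _ fun j _ => hdir j]
  have h2 : ∀ j, ∫ x, partialDeriv j f x * C j x = - ∫ x, f x * partialDeriv j (C j) x := fun j =>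
    integral_partialDeriv_mul hf hfs (hC j) j
  have h3 : ∀ j, Integrable fun x => f x * partialDeriv j (C j) x := fun j =>
    (hf.continuous.mul (contDiff_partialDeriv (m := 0) j (hC j)
      (by simp)).continuous).integrable_of_hasCompactSupport hfs.mul_right
  simp_rw [h2]
  rw [Finset.sum_neg_distrib, ← integral_finsetSum _ fun j _ => h3 j]
  simp_rw [← Finset.mul_sum]
  have h4 : ∀ x, ∑ j, partialDeriv j (C j) x = 0 := sum_partialDeriv_cofactor hv i₀
  simp [h4]

/-- The estimate for the pairing of a Jacobian determinant with a test function. -/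
theorem integral_mul_det_gradMatrix_le {v : Fin n → RSpace n → ℝ} (hv : ∀ i, ContDiff ℝ 2 (v i))
    {φ : RSpace n → ℝ} (hφ : ContDiff ℝ 1 φ) (hφs : HasCompactSupport φ) (i₀ : Fin n) {M : ℝ}
    (hM : ∀ j x, |partialDeriv j φ x| ≤ M) (hv₀ : Integrable fun x => |v i₀ x| ^ n)
    (hgrad : ∀ i j, Integrable fun x => |gradMatrix v x i j| ^ n) :
    |∫ x, φ x * (gradMatrix v x).det| ≤ (Nat.factorial n : ℝ) * M *
      ((∫ x, |v i₀ x| ^ n) + ∑ i, ∑ j, ∫ x, |gradMatrix v x i j| ^ n) := by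
  have hM0 : 0 ≤ M := (abs_nonneg _).trans (hM i₀ 0)
  have hsum : Integrable fun x => ∑ i, ∑ j, |gradMatrix v x i j| ^ n :=
    integrable_finsetSum _ fun i _ => integrable_finsetSum _ fun j _ => hgrad i j
  have heq : (∫ x, |v i₀ x| ^ n) + ∑ i, ∑ j, ∫ x, |gradMatrix v x i j| ^ n
      = ∫ x, (|v i₀ x| ^ n + ∑ i, ∑ j, |gradMatrix v x i j| ^ n) := by
    rw [integral_add hv₀ hsum,
      integral_finsetSum _ fun i _ => integrable_finsetSum _ fun j _ => hgrad i j]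
    congr 1
    exact Finset.sum_congr rfl fun i _ => (integral_finsetSum _ fun j _ => hgrad i j).symm
  rw [integral_mul_det_gradMatrix hv hφ hφs i₀, abs_neg, heq, ← integral_const_mul,
    ← Real.norm_eq_abs]
  refine norm_integral_le_of_norm_le ((hv₀.add hsum).const_mul _) (Eventually.of_forall fun x => ?_)
  refine Matrix.abs_det_le_of_forall_abs_le_mul (i₀ := i₀) i₀.pos hM0 (fun j => ?_) fun i hi j => ?_
  · rw [Matrix.updateRow_self, abs_mul, mul_comm]
    exact mul_le_mul_of_nonneg_right (hM j x) (abs_nonneg _)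
  · rw [Matrix.updateRow_ne hi]

end SmoothJacobian

/-! ### Mollification and the pairing of Sobolev Jacobians with test functions -/

section Mollify

variable {n : ℕ}

/-- The convolution of `f` with a normalised bump function. -/
def mollify (ρ : ContDiffBump (0 : RSpace n)) (f : RSpace n → ℝ) : RSpace n → ℝ :=
  convolution f (ρ.normed volume) (ContinuousLinearMap.lsmul ℝ ℝ) volume

theorem mollify_eq_integral (ρ : ContDiffBump (0 : RSpace n)) (f : RSpace n → ℝ) (x : RSpace n) :
    mollify ρ f x = ∫ y, f y * ρ.normed volume (x - y) := rfl

theorem mollify_eq_convolution (ρ : ContDiffBump (0 : RSpace n)) (f : RSpace n → ℝ) :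
    mollify ρ f = convolution (ρ.normed volume) f (ContinuousLinearMap.lsmul ℝ ℝ) volume := by
  ext x
  rw [convolution_lsmul_swap, mollify_eq_integral]
  simp_rw [smul_eq_mul, mul_comm]

theorem contDiff_mollify (ρ : ContDiffBump (0 : RSpace n)) {f : RSpace n → ℝ}
    (hf : LocallyIntegrable f) : ContDiff ℝ ∞ (mollify ρ f) :=
  ρ.hasCompactSupport_normed.contDiff_convolution_right _ hf ρ.contDiff_normed

/-- The normalised bump is the density of a probability measure `ν`, so Jensen's inequality
(monotonicity of `Lᵖ(ν)` norms in the exponent), Tonelli and translation invariance give the bound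
with constant exactly `1`. -/
theorem lintegral_enorm_mollify_pow_le (ρ : ContDiffBump (0 : RSpace n)) {f : RSpace n → ℝ}
    (hf : AEStronglyMeasurable f volume) {p : ℕ} (hp : 1 ≤ p) :
    ∫⁻ x, ‖mollify ρ f x‖ₑ ^ p ≤ ∫⁻ x, ‖f x‖ₑ ^ p := by
  set k : RSpace n → ℝ≥0∞ := fun y => ENNReal.ofReal (ρ.normed volume y) with hk
  have hkm : Measurable k := (ρ.contDiff_normed (n := 0)).continuous.measurable.ennreal_ofReal
  set ν : Measure (RSpace n) := volume.withDensity k with hν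
  have hνac : ν ≪ volume := withDensity_absolutelyContinuous _ _
  have hν1 : IsProbabilityMeasure ν := ⟨by
    rw [hν, withDensity_apply _ MeasurableSet.univ, Measure.restrict_univ, hk,
      ← ofReal_integral_eq_lintegral_ofReal ρ.integrable_normed
        (Eventually.of_forall ρ.nonneg_normed), ρ.integral_normed, ENNReal.ofReal_one]⟩
  have hfx : ∀ x, AEStronglyMeasurable (fun y => f (x - y)) volume := fun x =>
    hf.comp_quasiMeasurePreserving (quasiMeasurePreserving_sub_left volume x)
  have hpt : ∀ x, ‖mollify ρ f x‖ₑ ^ p ≤ ∫⁻ y, ‖f (x - y)‖ₑ ^ p ∂ν := by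
    intro x
    have h1 : ‖mollify ρ f x‖ₑ ≤ ∫⁻ y, ‖f (x - y)‖ₑ ∂ν := by
      rw [mollify_eq_convolution, convolution_lsmul]
      refine (enorm_integral_le_lintegral_enorm _).trans (le_of_eq ?_)
      rw [hν, lintegral_withDensity_eq_lintegral_mul₀ hkm.aemeasurable (hfx x).enorm]
      refine lintegral_congr fun y => ?_
      rw [enorm_smul, Real.enorm_eq_ofReal (ρ.nonneg_normed y)]
      rfl
    have h2 := eLpNorm_le_eLpNorm_of_exponent_le (p := 1) (q := p) (μ := ν)
      (by exact_mod_cast hp) ((hfx x).mono_ac hνac)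
    rw [eLpNorm_one_eq_lintegral_enorm, eLpNorm_eq_lintegral_rpow_enorm_toReal (by positivity)
      (by simp)] at h2
    have h3 := ENNReal.rpow_le_rpow (h1.trans h2) (Nat.cast_nonneg (α := ℝ) p)
    have hp0 : (p : ℝ) ≠ 0 := by positivity
    rw [ENNReal.toReal_natCast, ← ENNReal.rpow_mul, one_div, inv_mul_cancel₀ hp0,
      ENNReal.rpow_one] at h3
    simpa only [ENNReal.rpow_natCast] using h3
  calc ∫⁻ x, ‖mollify ρ f x‖ₑ ^ p ≤ ∫⁻ x, ∫⁻ y, ‖f (x - y)‖ₑ ^ p ∂ν := lintegral_mono hpt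
    _ = ∫⁻ y, (∫⁻ x, ‖f (x - y)‖ₑ ^ p) ∂ν := by
      refine lintegral_lintegral_swap (AEMeasurable.pow_const ?_ p)
      have h1 : AEStronglyMeasurable (fun q : RSpace n × RSpace n => f (q.1 - q.2))
          (volume.prod volume) :=
        hf.comp_quasiMeasurePreserving (quasiMeasurePreserving_sub volume volume)
      exact (h1.mono_ac (Measure.AbsolutelyContinuous.rfl.prod hνac)).enorm
    _ = ∫⁻ x, ‖f x‖ₑ ^ p := by
      simp_rw [lintegral_sub_right_eq_self (fun x => ‖f x‖ₑ ^ p)]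
      simp

theorem ofReal_integral_abs_pow {f : RSpace n → ℝ} {p : ℕ} (hp : p ≠ 0) (hf : MemLp f p volume) :
    ENNReal.ofReal (∫ x, |f x| ^ p) = ∫⁻ x, ‖f x‖ₑ ^ p := by
  have hi : Integrable fun x => |f x| ^ p := hf.integrable_norm_pow hp
  rw [ofReal_integral_eq_lintegral_ofReal hi
    (Eventually.of_forall fun x => by positivity)]
  refine lintegral_congr fun x => ?_
  rw [ENNReal.ofReal_pow (abs_nonneg _), Real.enorm_eq_ofReal_abs]

theorem memLp_mollify (ρ : ContDiffBump (0 : RSpace n)) {f : RSpace n → ℝ} {p : ℕ} (hp : 1 ≤ p)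
    (hf : MemLp f p volume) : MemLp (mollify ρ f) p volume := by
  have hp0 : (p : ℝ≥0∞) ≠ 0 := by positivity
  have hpt : (p : ℝ≥0∞) ≠ ⊤ := by simp
  refine ⟨(contDiff_mollify ρ
    (hf.locallyIntegrable (by exact_mod_cast hp))).continuous.aestronglyMeasurable, ?_⟩
  have h := hf.2
  rw [eLpNorm_lt_top_iff_lintegral_rpow_enorm_lt_top hp0 hpt] at h ⊢
  simp only [ENNReal.toReal_natCast, ENNReal.rpow_natCast] at h ⊢
  exact (lintegral_enorm_mollify_pow_le ρ hf.1 hp).trans_lt h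

theorem integral_abs_mollify_pow_le (ρ : ContDiffBump (0 : RSpace n)) {f : RSpace n → ℝ} {p : ℕ}
    (hp : 1 ≤ p) (hf : MemLp f p volume) :
    ∫ x, |mollify ρ f x| ^ p ≤ ∫ x, |f x| ^ p := by
  rw [← ENNReal.ofReal_le_ofReal_iff (integral_nonneg fun _ => pow_nonneg (abs_nonneg _) p),
    ofReal_integral_abs_pow (by omega) hf,
    ofReal_integral_abs_pow (by omega) (memLp_mollify ρ hp hf)]
  exact lintegral_enorm_mollify_pow_le ρ hf.1 hp

theorem SobolevMap.memLp_apply (u : SobolevMap n) (i : Fin n) :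
    MemLp (fun x => u.toFun x i) (n : ℝ≥0∞) volume :=
  u.memLp_toFun.mono ((EuclideanSpace.proj (𝕜 := ℝ) i).continuous.comp_aestronglyMeasurable
    u.memLp_toFun.1) (Eventually.of_forall fun _ => PiLp.norm_apply_le _ i)

/-- The weak derivative is tested against `y ↦ ρ(x - y)`; the sign from the reflection cancels the
sign in the definition. -/
theorem partialDeriv_mollify (hn : 1 ≤ n) (u : SobolevMap n) (ρ : ContDiffBump (0 : RSpace n))
    (i j : Fin n) (x : RSpace n) :
    partialDeriv j (mollify ρ fun y => u.toFun y i) x = mollify ρ (fun y => u.grad y i j) x := by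
  have hloc : LocallyIntegrable (fun y => u.toFun y i) :=
    (u.memLp_apply i).locallyIntegrable (by exact_mod_cast hn)
  set k := ρ.normed (volume : Measure (RSpace n)) with hk
  have hk1 : ContDiff ℝ 1 k := ρ.contDiff_normed
  have hks : HasCompactSupport k := ρ.hasCompactSupport_normed
  have hder := (hks.hasFDerivAt_convolution_right (ContinuousLinearMap.lsmul ℝ ℝ)
    hloc hk1 x).fderiv
  have h1 : partialDeriv j (mollify ρ fun y => u.toFun y i) x
      = ∫ y, u.toFun y i * fderiv ℝ k (x - y) (EuclideanSpace.single j 1) := by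
    change fderiv ℝ (convolution _ k _ _) x _ = _
    rw [hder, convolution_precompR_apply _ hloc (hks.fderiv (𝕜 := ℝ))
      (hk1.continuous_fderiv one_ne_zero)]
    rfl
  let φ : TestFn n := ⟨fun y => k (x - y), ρ.contDiff_normed.comp (contDiff_const.sub contDiff_id),
    hks.comp_homeomorph (Homeomorph.subLeft x), Set.subset_univ _⟩
  have h2 : ∀ y, partialDeriv j φ y = - fderiv ℝ k (x - y) (EuclideanSpace.single j 1) := by
    intro y
    have hd := ((hk1.differentiable one_ne_zero (x - y)).hasFDerivAt.comp y
      ((hasFDerivAt_id y).const_sub x)).fderiv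
    change fderiv ℝ (k ∘ fun y => x - y) y _ = _
    refine (congrArg (fun T => T (EuclideanSpace.single j 1)) hd).trans ?_
    simp
  have h3 := u.weak_deriv i j φ
  simp_rw [h2, mul_neg, integral_neg, neg_inj] at h3
  rw [h1, h3]
  rfl

theorem exists_contDiffBump_seq : ∃ ρ : ℕ → ContDiffBump (0 : RSpace n),
    ∀ f : RSpace n → ℝ, LocallyIntegrable f →
      ∀ᵐ x, Tendsto (fun m => mollify (ρ m) f x) atTop (𝓝 (f x)) := by
  -- The ratio of outer to inner radius is kept equal to `2`, as Lebesgue differentiation requires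
  -- it to stay bounded.
  let ρ : ℕ → ContDiffBump (0 : RSpace n) := fun m =>
    ⟨1 / ((m : ℝ) + 1), 2 * (1 / ((m : ℝ) + 1)), by positivity, by
      have : 0 < 1 / ((m : ℝ) + 1) := by positivity
      linarith⟩
  refine ⟨ρ, fun f hf => ?_⟩
  have h0 : Tendsto (fun m => (ρ m).rOut) atTop (𝓝 0) := by
    have h := (tendsto_one_div_add_atTop_nhds_zero_nat (𝕜 := ℝ)).const_mul 2
    rwa [mul_zero] at h
  have h := ContDiffBump.ae_convolution_tendsto_right_of_locallyIntegrable (K := 2) (μ := volume)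
    h0 (Eventually.of_forall fun m => le_rfl) hf
  simpa only [mollify_eq_convolution] using h

theorem SobolevMap.integral_pow_le_one (hn : 1 ≤ n) (u : SobolevMap n) (hu : u.sobolevNorm ≤ 1)
    (i₀ : Fin n) :
    (∫ x, |u.toFun x i₀| ^ n) + ∑ i, ∑ j, ∫ x, |u.grad x i j| ^ n ≤ 1 := by
  have hn0 : n ≠ 0 := by omega
  have h1 : (∫⁻ x, ‖u.toFun x‖ₑ ^ n) + ∑ i, ∑ j, ∫⁻ x, ‖u.grad x i j‖ₑ ^ n ≤ 1 := by
    have h := ENNReal.rpow_le_rpow hu (Nat.cast_nonneg (α := ℝ) n)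
    have hp0 : (n : ℝ) ≠ 0 := by positivity
    rwa [SobolevMap.sobolevNorm, ← ENNReal.rpow_mul, one_div, inv_mul_cancel₀ hp0,
      ENNReal.rpow_one, ENNReal.one_rpow] at h
  have h0 : ∫⁻ x, ‖u.toFun x i₀‖ₑ ^ n ≤ ∫⁻ x, ‖u.toFun x‖ₑ ^ n := by
    refine lintegral_mono fun x => ?_
    gcongr
    exact enorm_le_iff_norm_le.2 (PiLp.norm_apply_le (u.toFun x) i₀)
  have hsum : ∀ i j, 0 ≤ ∫ x, |u.grad x i j| ^ n := fun i j =>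
    integral_nonneg fun x => by positivity
  rw [← ENNReal.ofReal_le_ofReal_iff zero_le_one, ENNReal.ofReal_one,
    ENNReal.ofReal_add (integral_nonneg fun x => by positivity)
      (Finset.sum_nonneg fun i _ => Finset.sum_nonneg fun j _ => hsum i j),
    ENNReal.ofReal_sum_of_nonneg fun i _ => Finset.sum_nonneg fun j _ => hsum i j,
    ofReal_integral_abs_pow hn0 (u.memLp_apply i₀)]
  refine le_trans (add_le_add h0 (le_of_eq ?_)) h1
  refine Finset.sum_congr rfl fun i _ => ?_
  rw [ENNReal.ofReal_sum_of_nonneg fun j _ => hsum i j]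
  exact Finset.sum_congr rfl fun j _ => ofReal_integral_abs_pow hn0 (u.memLp_grad i j)

/-- The smooth estimate passes to the limit by Fatou's lemma, so almost everywhere convergence of
the mollified gradients is enough. Adding `C ∑ |A i j|ⁿ` makes the integrand nonnegative; since
mollification does not increase `Lⁿ` norms, the added term contributes at most `C T` before the
limit and exactly `C T` after it, and cancels. -/
theorem SobolevMap.integral_mul_jacobian_le (hn : 1 ≤ n) (u : SobolevMap n)
    (hu : u.sobolevNorm ≤ 1) {φ : RSpace n → ℝ} (hφ : ContDiff ℝ 1 φ) (hφs : HasCompactSupport φ)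
    {M : ℝ} (hM : ∀ j x, |partialDeriv j φ x| ≤ M) :
    ∫ x, φ x * u.jacobian x ≤ (Nat.factorial n : ℝ) * M := by
  have hn0 : n ≠ 0 := by omega
  let i₀ : Fin n := ⟨0, hn⟩
  have hM0 : 0 ≤ M := (abs_nonneg _).trans (hM i₀ 0)
  obtain ⟨ρ, hρ⟩ := exists_contDiffBump_seq (n := n)
  obtain ⟨b, hb⟩ := hφ.continuous.bounded_above_of_compact_support hφs
  have hb0 : 0 ≤ b := (norm_nonneg _).trans (hb 0)
  have hloc : ∀ i, LocallyIntegrable fun x => u.toFun x i := fun i =>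
    (u.memLp_apply i).locallyIntegrable (by exact_mod_cast hn)
  set v : ℕ → Fin n → RSpace n → ℝ := fun m i => mollify (ρ m) fun x => u.toFun x i
  have hv : ∀ m i, ContDiff ℝ 2 (v m i) := fun m i =>
    (contDiff_mollify (ρ m) (hloc i)).of_le (by norm_cast)
  have hgrad : ∀ m i j x, gradMatrix (v m) x i j = mollify (ρ m) (fun y => u.grad y i j) x :=
    fun m i j x => partialDeriv_mollify hn u (ρ m) i j x
  set S : (RSpace n → Matrix (Fin n) (Fin n) ℝ) → RSpace n → ℝ := fun A x =>
    ∑ i, ∑ j, |A x i j| ^ n with hS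
  set C : ℝ := b * Nat.factorial n with hC
  set G : (RSpace n → Matrix (Fin n) (Fin n) ℝ) → RSpace n → ℝ := fun A x =>
    C * S A x + φ x * (A x).det with hG
  have hG0 : ∀ A x, |φ x * (A x).det| ≤ C * S A x := by
    intro A x
    rw [abs_mul, hC, mul_assoc]
    exact mul_le_mul (hb x) (Matrix.abs_det_le_sum_pow hn _) (abs_nonneg _) hb0
  have hint : ∀ A : RSpace n → Matrix (Fin n) (Fin n) ℝ,
      (∀ i j, MemLp (fun x => A x i j) n volume) →
      (∀ i j, Integrable fun x => |A x i j| ^ n) ∧ Integrable (S A) ∧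
        Integrable (fun x => φ x * (A x).det) := by
    intro A hA
    have h1 : ∀ i j, Integrable fun x => |A x i j| ^ n := fun i j =>
      (hA i j).integrable_norm_pow hn0
    have h2 : Integrable (S A) :=
      integrable_finsetSum _ fun i _ => integrable_finsetSum _ fun j _ => h1 i j
    refine ⟨h1, h2, (h2.const_mul C).mono' ?_ (Eventually.of_forall fun x => hG0 A x)⟩
    refine hφ.continuous.aestronglyMeasurable.mul ?_
    simp only [Matrix.det_apply]
    exact Finset.aestronglyMeasurable_fun_sum _ fun σ _ =>
      (Finset.aestronglyMeasurable_fun_prod _ fun i _ => (hA _ _).1).const_smul _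
  have hlint : ∀ A : RSpace n → Matrix (Fin n) (Fin n) ℝ,
      (∀ i j, MemLp (fun x => A x i j) n volume) →
      ∫⁻ x, ENNReal.ofReal (G A x) = ENNReal.ofReal
        (C * ∑ i, ∑ j, (∫ x, |A x i j| ^ n) + ∫ x, φ x * (A x).det) := by
    intro A hA
    obtain ⟨h1, h2, h3⟩ := hint A hA
    have h4 : Integrable (G A) := (h2.const_mul C).add h3
    rw [← ofReal_integral_eq_lintegral_ofReal h4
      (Eventually.of_forall fun x => ?_)]
    · congr 1
      rw [hG, integral_add (h2.const_mul C) h3, integral_const_mul]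
      congr 2
      rw [hS, integral_finsetSum _ fun i _ => integrable_finsetSum _ fun j _ => h1 i j]
      exact Finset.sum_congr rfl fun i _ => integral_finsetSum _ fun j _ => h1 i j
    · have := neg_le_of_abs_le (hG0 A x)
      change 0 ≤ C * S A x + φ x * (A x).det
      linarith
  have hmem : ∀ m i j, MemLp (fun x => gradMatrix (v m) x i j) n volume := fun m i j => by
    simp_rw [hgrad]
    exact memLp_mollify (ρ m) hn (u.memLp_grad i j)
  set T : ℝ := ∑ i, ∑ j, ∫ x, |u.grad x i j| ^ n with hT
  have hT : ∀ m, ∑ i, ∑ j, ∫ x, |gradMatrix (v m) x i j| ^ n ≤ T := fun m => by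
    refine Finset.sum_le_sum fun i _ => Finset.sum_le_sum fun j _ => ?_
    simp_rw [hgrad]
    exact integral_abs_mollify_pow_le (ρ m) hn (u.memLp_grad i j)
  have hbound : ∀ m, ∫⁻ x, ENNReal.ofReal (G (gradMatrix (v m)) x)
      ≤ ENNReal.ofReal (C * T + (Nat.factorial n : ℝ) * M) := by
    intro m
    rw [hlint _ (hmem m)]
    refine ENNReal.ofReal_le_ofReal (add_le_add (by gcongr; exact hT m) ?_)
    have h1 := integral_mul_det_gradMatrix_le (hv m) hφ hφs i₀ hM
      ((memLp_mollify (ρ m) hn (u.memLp_apply i₀)).integrable_norm_pow hn0)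
      (hint _ (hmem m)).1
    have h2 := integral_abs_mollify_pow_le (ρ m) hn (u.memLp_apply i₀)
    have h3 := u.integral_pow_le_one hn hu i₀
    refine (le_abs_self _).trans (h1.trans (mul_le_of_le_one_right (by positivity) ?_))
    exact (add_le_add h2 (hT m)).trans h3
  have hae : ∀ᵐ x, ∀ i j, Tendsto (fun m => gradMatrix (v m) x i j) atTop (𝓝 (u.grad x i j)) := by
    rw [ae_all_iff]; intro i
    rw [ae_all_iff]; intro j
    simp_rw [hgrad]
    exact hρ _ ((u.memLp_grad i j).locallyIntegrable (by exact_mod_cast hn))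
  have hlim : ∀ᵐ x, ENNReal.ofReal (G u.grad x)
      = liminf (fun m => ENNReal.ofReal (G (gradMatrix (v m)) x)) atTop := by
    filter_upwards [hae] with x hx
    refine (Tendsto.liminf_eq (ENNReal.tendsto_ofReal ?_)).symm
    have hmat : Tendsto (fun m => gradMatrix (v m) x) atTop (𝓝 (u.grad x)) :=
      tendsto_pi_nhds.2 fun i => tendsto_pi_nhds.2 fun j => hx i j
    have hdet := ((continuous_id (X := Matrix (Fin n) (Fin n) ℝ)).matrix_det.tendsto _).comp hmat
    exact ((tendsto_finsetSum _ fun i _ => tendsto_finsetSum _ fun j _ =>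
      ((hx i j).abs.pow n)).const_mul C).add (hdet.const_mul (φ x))
  have hmeas : ∀ m, Measurable fun x => ENNReal.ofReal (G (gradMatrix (v m)) x) := by
    intro m
    have hc : ∀ i j, ContDiff ℝ 0 fun x => gradMatrix (v m) x i j := fun i j =>
      contDiff_partialDeriv (m := 0) j (hv m i) (by norm_num)
    have hcont : Continuous (G (gradMatrix (v m))) :=
      (continuous_const.mul (continuous_finsetSum _ fun i _ => continuous_finsetSum _ fun j _ =>
        ((hc i j).continuous.abs.pow n))).add (hφ.continuous.mul (contDiff_det hc).continuous)
    exact hcont.measurable.ennreal_ofReal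
  have hfatou : ∫⁻ x, ENNReal.ofReal (G u.grad x)
      ≤ ENNReal.ofReal (C * T + (Nat.factorial n : ℝ) * M) := by
    rw [lintegral_congr_ae hlim]
    refine (lintegral_liminf_le hmeas).trans ?_
    exact (liminf_le_liminf (Eventually.of_forall hbound)).trans (by simp)
  have hT0 : 0 ≤ T := Finset.sum_nonneg fun i _ => Finset.sum_nonneg fun j _ =>
    integral_nonneg fun x => by positivity
  rw [hlint _ u.memLp_grad, ENNReal.ofReal_le_ofReal_iff (by positivity)] at hfatou
  exact le_of_add_le_add_left hfatou

theorem SobolevMap.abs_integral_jacobian_mul_le (hn : 1 ≤ n) (u : SobolevMap n)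
    (hu : u.sobolevNorm ≤ 1) {φ : RSpace n → ℝ} (hφ : ContDiff ℝ 1 φ) (hφs : HasCompactSupport φ)
    {M : ℝ} (hM : ∀ j x, |partialDeriv j φ x| ≤ M) :
    |∫ x, u.jacobian x * φ x| ≤ (Nat.factorial n : ℝ) * M := by
  simp_rw [mul_comm (u.jacobian _)]
  refine abs_le.2 ⟨neg_le.1 ?_, u.integral_mul_jacobian_le hn hu hφ hφs hM⟩
  have h := u.integral_mul_jacobian_le hn hu (φ := fun x => -φ x) (M := M) hφ.neg hφs.neg
    fun j x => by simpa [partialDeriv] using hM j x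
  simpa only [neg_mul, integral_neg] using h

end Mollify

/-! ### Sums of Jacobians are of the first category -/

section Category

variable {n : ℕ}

/-- The chain rule adds one factor `1/t` to the normalisation `t⁻ⁿ`. -/
theorem exists_abs_partialDeriv_mollifier_le (η : TestFn n) : ∃ L : ℝ, 0 ≤ L ∧
    ∀ (t : Set.Ioi (0 : ℝ)) (x : RSpace n) (j : Fin n) (y : RSpace n),
      |partialDeriv j (mollifier η t x) y| ≤ ((t : ℝ) ^ (n + 1))⁻¹ * L := by
  obtain ⟨L, hL0, hL, -⟩ := η.exists_lipschitz
  refine ⟨L, hL0, fun t x j y => ?_⟩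
  have ht : (0 : ℝ) < t := t.2
  have hη : HasFDerivAt η (fderiv ℝ η ((t : ℝ)⁻¹ • (x - y))) ((t : ℝ)⁻¹ • (x - y)) :=
    (η.contDiff.differentiable (by simp) _).hasFDerivAt
  have hd := ((hη.comp y (((hasFDerivAt_id y).const_sub x).const_smul (t : ℝ)⁻¹)).const_mul
    ((t : ℝ) ^ n)⁻¹).fderiv
  have h1 : partialDeriv j (mollifier η t x) y = - (((t : ℝ) ^ (n + 1))⁻¹ *
      fderiv ℝ η ((t : ℝ)⁻¹ • (x - y)) (EuclideanSpace.single j 1)) := by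
    refine (congrArg (fun T => T (EuclideanSpace.single j 1)) hd).trans ?_
    simp [pow_succ, mul_assoc, mul_left_comm]
  rw [h1, abs_neg, abs_mul, abs_of_pos (by positivity)]
  gcongr
  rw [← Real.norm_eq_abs]
  refine (ContinuousLinearMap.le_opNorm _ _).trans ?_
  simpa using hL _

/-- The sums of Jacobians with coefficients of `ℓ¹` norm at most `k`. -/
def boundedJacobianSums (η : TestFn n) (k : ℕ) : Set (HardySpace η) :=
  {h | ∃ (l : ℕ → ℝ) (u : ℕ → SobolevMap n),
    (∀ j, (u j).sobolevNorm ≤ 1) ∧ (Summable fun j => |l j|) ∧ ∑' j, |l j| ≤ k ∧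
      ∀ φ : 𝓢(RSpace n, ℝ), HasSum (fun j => l j * ∫ x, (u j).jacobian x * φ x) (h.toDist φ)}

theorem jacobianSums_eq_iUnion (η : TestFn n) :
    jacobianSums η = ⋃ k : ℕ, boundedJacobianSums η k := by
  ext h
  rw [Set.mem_iUnion]
  constructor
  · rintro ⟨l, u, hu, hl, hh⟩
    obtain ⟨k, hk⟩ := exists_nat_ge (∑' j, |l j|)
    exact ⟨k, l, u, hu, hl, hk, hh⟩
  · rintro ⟨k, l, u, hu, hl, -, hh⟩
    exact ⟨l, u, hu, hl, hh⟩

/-- The decisive bound: its decay in `t` is one power faster than the `t⁻ⁿ` found for dilates of a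
fixed element. It is pointwise in `x` and the same for all sums of the given `ℓ¹` size. -/
theorem exists_abs_distConv_boundedJacobianSums_le (hn : 1 ≤ n) (η : TestFn n) :
    ∃ K : ℝ, 0 ≤ K ∧ ∀ k : ℕ, ∀ h ∈ boundedJacobianSums η k, ∀ (t : Set.Ioi (0 : ℝ)) (x : RSpace n),
      |distConv η h.toDist t x| ≤ k * (K * ((t : ℝ) ^ (n + 1))⁻¹) := by
  obtain ⟨L, hL0, hL⟩ := exists_abs_partialDeriv_mollifier_le η
  refine ⟨(Nat.factorial n : ℝ) * L, by positivity, ?_⟩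
  rintro k h ⟨l, u, hu, hl, hk, hh⟩ t x
  have ht : (0 : ℝ) < t := t.2
  set B : ℝ := (Nat.factorial n : ℝ) * (((t : ℝ) ^ (n + 1))⁻¹ * L) with hB
  have hs : HasCompactSupport (mollifier η t x) := by
    have h := η.hasCompactSupport.comp_homeomorph
      ((Homeomorph.subLeft x).trans (Homeomorph.smulOfNeZero _ (inv_ne_zero ht.ne')))
    exact HasCompactSupport.mul_left h
  have hterm : ∀ j, ‖l j * ∫ y, (u j).jacobian y * mollifier η t x y‖ ≤ |l j| * B := fun j => by
    rw [norm_mul]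
    exact mul_le_mul_of_nonneg_left ((u j).abs_integral_jacobian_mul_le hn (hu j)
      ((mollifier η t x).smooth 1) hs (hL t x)) (abs_nonneg _)
  have h1 := tsum_of_norm_bounded (hl.hasSum.mul_right B) hterm
  rw [(hh (mollifier η t x)).tsum_eq] at h1
  calc _ ≤ (∑' j, |l j|) * B := h1
    _ ≤ k * B := by gcongr
    _ = _ := by rw [hB]; ring

/-- Chebyshev's inequality for the maximal function, which dominates each single scale. -/
theorem ofReal_mul_volume_le_norm {η : TestFn n} (h : HardySpace η) {c : ℝ} {E : Set (RSpace n)}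
    (t : Set.Ioi (0 : ℝ)) (hE : ∀ x ∈ E, c ≤ |distConv η h.toDist t x|) :
    ENNReal.ofReal c * volume E ≤ ENNReal.ofReal ‖h‖ := by
  have hh : ∫⁻ x, maximalFn η h.toDist x < ⊤ := h.2
  rw [HardySpace.norm_def, ENNReal.ofReal_toReal hh.ne]
  have hsub : E ⊆ {x | ENNReal.ofReal c ≤ maximalFn η h.toDist x} := fun x hx => by
    refine le_trans ?_ (le_iSup (fun t => ‖distConv η h.toDist t x‖ₑ) t)
    rw [Real.enorm_eq_ofReal_abs]
    exact ENNReal.ofReal_le_ofReal (hE x hx)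
  calc _ ≤ ENNReal.ofReal c * volume {x | ENNReal.ofReal c ≤ maximalFn η h.toDist x} := by gcongr
    _ ≤ _ := mul_meas_ge_le_lintegral (measurable_maximalFn η h.toDist) _

theorem isNowhereDense_boundedJacobianSums (hn : 1 ≤ n) (η : TestFn n) (hη : ∃ x, η x ≠ 0)
    (k : ℕ) : IsNowhereDense (boundedJacobianSums η k) := by
  rw [IsNowhereDense, Set.eq_empty_iff_forall_notMem]
  intro g hg
  obtain ⟨r, hr, hball⟩ := Metric.mem_nhds_iff.1 (mem_interior_iff_mem_nhds.1 hg)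
  obtain ⟨h, hh⟩ := exists_hardySpace_distConv_ne_zero hn η hη
  obtain ⟨K, hK0, hK⟩ := exists_abs_distConv_boundedJacobianSums_le hn η
  set c : ℝ := |distConv η h.toDist ⟨1, Set.mem_Ioi.2 one_pos⟩ 0| / 2 with hc
  have hc0 : 0 < c := half_pos (abs_pos.2 hh)
  set ε : ℝ := r / (‖h‖ + 1) with hε
  have hε0 : 0 < ε := by positivity
  -- This makes `s⁻ⁿ ε c > 2 k K s^{-(n+1)}`. The factor `2` is there because two sums, `a` and `b`,
  -- are compared.
  obtain ⟨s₀, hs₀⟩ := exists_nat_gt (2 * k * K / (ε * c))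
  have hs0 : (0 : ℝ) < s₀ := lt_of_le_of_lt (by positivity) hs₀
  set s : Set.Ioi (0 : ℝ) := ⟨s₀, hs0⟩ with hs
  set E : Set (RSpace n) :=
    {x | c < |distConv η h.toDist ⟨1, Set.mem_Ioi.2 one_pos⟩ ((s : ℝ)⁻¹ • x)|} with hE
  have hEo : IsOpen E := isOpen_lt continuous_const
    ((continuous_distConv η h.toDist _).comp (continuous_const_smul _)).abs
  have hEne : E.Nonempty := ⟨0, by
    change c < |distConv η h.toDist ⟨1, Set.mem_Ioi.2 one_pos⟩ ((s : ℝ)⁻¹ • 0)|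
    rw [smul_zero, hc]
    exact half_lt_self (abs_pos.2 hh)⟩
  have hEpos : 0 < volume E := hEo.measure_pos _ hEne
  set H : HardySpace η := ε • h.dilate s with hH
  have hHr : ‖H‖ < r := by
    have h1 : ‖H‖ = ε * ‖h.dilate s‖ := by
      have := HardySpace.seminormedCore.norm_smul ε (h.dilate s)
      rwa [Real.norm_of_nonneg hε0.le] at this
    calc ‖H‖ ≤ ε * ‖h‖ := h1.trans_le (mul_le_mul_of_nonneg_left (h.norm_dilate_le s) hε0.le)
      _ < ε * (‖h‖ + 1) := by gcongr; linarith
      _ = r := by rw [hε]; field_simp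
  have hg1 : g ∈ closure (boundedJacobianSums η k) := hball (Metric.mem_ball_self hr)
  have hg2 : g + H ∈ closure (boundedJacobianSums η k) := hball (by simpa using hHr)
  set γ : ℝ := ((s : ℝ) ^ n)⁻¹ * (ε * c) - 2 * k * (K * ((s : ℝ) ^ (n + 1))⁻¹) with hγ
  have hγ0 : 0 < γ := by
    have h1 : 2 * k * K < s * (ε * c) := by
      rwa [div_lt_iff₀ (by positivity)] at hs₀
    have h2 : γ = ((s : ℝ) ^ (n + 1))⁻¹ * (s * (ε * c) - 2 * k * K) := by
      have hs' : (s : ℝ) ≠ 0 := hs0.ne'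
      rw [hγ, pow_succ]
      field_simp
    rw [h2]
    have : (0 : ℝ) < ((s : ℝ) ^ (n + 1))⁻¹ := inv_pos.2 (pow_pos hs0 _)
    exact mul_pos this (by linarith)
  -- On `E` the convolution of `b - a - H` with `η_s` is at least `γ` in absolute value, while its
  -- Hardy norm is at most `2 δ`. Neither `γ` nor `E` depends on `δ`, so `δ → 0` gives the
  -- contradiction.
  have hsmall : ∀ δ > 0, ENNReal.ofReal γ * volume E ≤ ENNReal.ofReal (2 * δ) := by
    intro δ hδ
    obtain ⟨a, ha, hag⟩ := Metric.mem_closure_iff.1 hg1 δ hδ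
    obtain ⟨b, hb, hbg⟩ := Metric.mem_closure_iff.1 hg2 δ hδ
    have hnorm : ‖b - a - H‖ ≤ 2 * δ := by
      have h1 : b - a - H = (g - a) - (g + H - b) := by abel
      rw [dist_eq_norm] at hag hbg
      rw [h1]
      exact (norm_sub_le _ _).trans (by linarith)
    refine le_trans (ofReal_mul_volume_le_norm (b - a - H) s fun x hx => ?_)
      (ENNReal.ofReal_le_ofReal hnorm)
    have h2 : distConv η (b - a - H).toDist s x = distConv η b.toDist s x
        - distConv η a.toDist s x - ε * distConv η (dilate s h.toDist) s x := rfl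
    have h3 := hK k a ha s x
    have h4 := hK k b hb s x
    have h5 : ((s : ℝ) ^ n)⁻¹ * (ε * c) ≤ |ε * distConv η (dilate s h.toDist) s x| := by
      have h6 : (⟨(s : ℝ) / s, Set.mem_Ioi.2 (div_pos s.2 s.2)⟩ : Set.Ioi (0 : ℝ))
          = ⟨1, Set.mem_Ioi.2 one_pos⟩ := Subtype.ext (div_self hs0.ne')
      rw [distConv_dilate, h6, abs_mul, abs_mul, abs_of_pos hε0,
        abs_of_pos (inv_pos.2 (pow_pos hs0 n)), mul_left_comm]
      have h7 : (0 : ℝ) < ((s : ℝ) ^ n)⁻¹ := inv_pos.2 (pow_pos hs0 n)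
      exact mul_le_mul_of_nonneg_left (mul_le_mul_of_nonneg_left (le_of_lt hx) h7.le) hε0.le
        |>.trans_eq' (by ring)
    rw [h2]
    have h8 := abs_sub_abs_le_abs_sub (ε * distConv η (dilate s h.toDist) s x)
      (distConv η b.toDist s x - distConv η a.toDist s x)
    rw [abs_sub_comm (ε * _)] at h8
    have h9 := abs_sub (distConv η b.toDist s x) (distConv η a.toDist s x)
    rw [hγ]
    linarith
  have hzero : ENNReal.ofReal γ * volume E ≤ 0 := by
    refine ENNReal.le_of_forall_pos_le_add fun δ hδ _ => ?_
    have := hsmall (δ / 2) (by positivity)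
    rwa [mul_div_cancel₀ _ two_ne_zero, ENNReal.ofReal_coe_nnreal, ← zero_add (δ : ℝ≥0∞)] at this
  exact (ENNReal.mul_pos (ENNReal.ofReal_pos.2 hγ0).ne' hEpos.ne').not_ge hzero

end Category

end

theorem theorem1p2 (n : ℕ) (hn : 2 ≤ n) (η : TestFn n) (hη : (∫ x, η x) ≠ 0) :
    IsMeagre (jacobianSums η) := by
  have hne : ∃ x, η x ≠ 0 := by
    by_contra! h
    exact hη (by simp [h])
  rw [jacobianSums_eq_iUnion]
  exact isMeagre_iUnion fun k =>
    (isNowhereDense_boundedJacobianSums (by omega) η hne k).isMeagre
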